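/- There is an absolute constant $C>0$ such that for every $d\in\mathbb{N}$ there are a randomized algorithm and a constant $D=D(d)$ with the following properties. The algorithm takes as input an arbitrary real matrix $A\in\mathbb{R}^{m\times n}$ and, whatever the outcome of its coin tosses, stops after at most $D\,(m+n+1)^D$ steps. If $m,n\ge 2$, it always outputs a coloring $\mathbf{x}\in\{-1,+1\}^n$, and with probability at least $1-(m+n)^{-d}$ this coloring satisfies $$\|A\mathbf{x}\|_\infty\le C\,\sqrt{\log m\cdot\log n}\cdot\mathsf{detLB}(A).$$ Here $\mathsf{detLB}(A)=\max_{k\ge 1}\max_{|S|=|T|=k}|\det A_{S,T}|^{1/k}$, where $A_{S,T}$ is the submatrix of $A$ with rows $S\subseteq[m]$ and columns $T\subseteq[n]$. An algorithm is a single finite program, the same for all $m$, $n$ and $A$, of a randomized real RAM: a step is an assignment, a test or a toss of a fair coin; real numbers can be added, subtracted, multiplied, divided and compared exactly at unit cost, natural numbers (used for counting and addressing) can be added, subtracted and compared, and the only constants are natural numbers. -/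

import Mathlib

open scoped Matrix ENNReal

noncomputable section

/-! ### The determinant lower bound -/

/-- The values `|det B| ^ (1/k)` over all `k × k` submatrices `B` of `A`, `k ≥ 1`.  The rows and
the columns of `B` are listed in increasing order. -/
def detValues {m n : ℕ} (A : Matrix (Fin m) (Fin n) ℝ) : Set ℝ :=
  {r | ∃ k : ℕ, 1 ≤ k ∧ ∃ (f : Fin k ↪o Fin m) (g : Fin k ↪o Fin n),
    r = |(A.submatrix f g).det| ^ (1 / (k : ℝ))}

/-- The determinant lower bound of `A`: the maximum of `detValues A`, which is a finite set, and
nonempty as soon as `A` has a row and a column. -/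
def detLB {m n : ℕ} (A : Matrix (Fin m) (Fin n) ℝ) : ℝ := sSup (detValues A)

/-! ### A randomized real RAM

The memory holds integer registers, used for counting and for addressing, and two-dimensional
arrays of real numbers.  Integers can be added, subtracted and compared; reals can be added,
subtracted, multiplied, divided and compared, exactly and at unit cost.  The only constants are
natural numbers, there is no rounding of a real to an integer, and there is an instruction that
tosses a fair coin.  A program is one finite text that serves all input sizes. -/

namespace RealRAM

/-- Memory contents: the integer registers, and the entries of the arrays (array name, row,
column). -/
structure Memory where
  idx : ℕ → ℕ
  arr : ℕ → ℕ → ℕ → ℝ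

/-- Store `v` in integer register `x`. -/
def Memory.setIdx (s : Memory) (x v : ℕ) : Memory where
  idx := fun y => if y = x then v else s.idx y
  arr := s.arr

/-- Store `v` in entry `(i, j)` of array `a`. -/
def Memory.setArr (s : Memory) (a i j : ℕ) (v : ℝ) : Memory where
  idx := s.idx
  arr := fun b k l => if b = a ∧ k = i ∧ l = j then v else s.arr b k l

/-- Integer expressions. -/
inductive IExpr where
  | lit (c : ℕ)
  | reg (x : ℕ)
  | add (e f : IExpr)
  | sub (e f : IExpr)

/-- Subtraction is truncated at `0`. -/
def IExpr.eval (s : Memory) : IExpr → ℕ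
  | .lit c => c
  | .reg x => s.idx x
  | .add e f => e.eval s + f.eval s
  | .sub e f => e.eval s - f.eval s

/-- Real expressions; `get a i j` reads entry `(i, j)` of array `a`. -/
inductive RExpr where
  | ofIdx (e : IExpr)
  | get (a : ℕ) (i j : IExpr)
  | add (e f : RExpr)
  | sub (e f : RExpr)
  | mul (e f : RExpr)
  | div (e f : RExpr)

/-- Division by zero returns `0`. -/
def RExpr.eval (s : Memory) : RExpr → ℝ
  | .ofIdx e => (e.eval s : ℝ)
  | .get a i j => s.arr a (i.eval s) (j.eval s)
  | .add e f => e.eval s + f.eval s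
  | .sub e f => e.eval s - f.eval s
  | .mul e f => e.eval s * f.eval s
  | .div e f => e.eval s / f.eval s

/-- Conditions. -/
inductive Test where
  | iLt (e f : IExpr)
  | rLt (e f : RExpr)
  | neg (b : Test)
  | conj (b c : Test)

def Test.Holds (s : Memory) : Test → Prop
  | .iLt e f => e.eval s < f.eval s
  | .rLt e f => e.eval s < f.eval s
  | .neg b => ¬ b.Holds s
  | .conj b c => b.Holds s ∧ c.Holds s

/-- Programs. -/
inductive Prog where
  | skip
  | setIdx (x : ℕ) (e : IExpr)
  | setArr (a : ℕ) (i j : IExpr) (e : RExpr)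
  | coin (x : ℕ)
  | seq (p q : Prog)
  | branch (b : Test) (p q : Prog)
  | loop (b : Test) (p : Prog)

/-- A configuration: the stack of programs that remain to be executed, and the memory.  The
machine has halted when the stack is empty. -/
abbrev Config : Type := List Prog × Memory

open Classical in
/-- One step of the machine, which costs one unit of time.  The expressions in a step have a size
bounded in terms of the program, so that counting every single arithmetic operation would change
the running time by a constant factor only. -/
def step : Config → PMF Config
  | ([], s) => PMF.pure ([], s)
  | (.skip :: k, s) => PMF.pure (k, s)
  | (.setIdx x e :: k, s) => PMF.pure (k, s.setIdx x (e.eval s))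
  | (.setArr a i j e :: k, s) =>
      PMF.pure (k, s.setArr a (i.eval s) (j.eval s) (e.eval s))
  | (.coin x :: k, s) =>
      (PMF.uniformOfFintype Bool).map fun c => (k, s.setIdx x (if c then 1 else 0))
  | (.seq p q :: k, s) => PMF.pure (p :: q :: k, s)
  | (.branch b p q :: k, s) => PMF.pure ((if b.Holds s then p else q) :: k, s)
  | (.loop b p :: k, s) => PMF.pure (if b.Holds s then p :: .loop b p :: k else k, s)

/-- The distribution of the configuration after `t` steps. -/
def run : ℕ → Config → PMF Config
  | 0, c => PMF.pure c
  | t + 1, c => (step c).bind (run t)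

/-- The initial configuration on input `A`: integer registers `0` and `1` hold the numbers of rows
and columns of `A`, array `0` holds the entries of `A`, and everything else is `0`. -/
def start (p : Prog) {m n : ℕ} (A : Matrix (Fin m) (Fin n) ℝ) : Config :=
  ([p],
   { idx := fun x => if x = 0 then m else if x = 1 then n else 0
     arr := fun a i j => if h : a = 0 ∧ i < m ∧ j < n then A ⟨i, h.2.1⟩ ⟨j, h.2.2⟩ else 0 })

/-- The output: the first `n` entries of row `0` of array `1`. -/
def output (n : ℕ) (c : Config) : Fin n → ℝ := fun j => c.2.arr 1 0 j

/-- On every `m × n` input, `p` halts within `T m n` steps, whatever the coins show. -/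
def HaltsWithin (p : Prog) (T : ℕ → ℕ → ℕ) : Prop :=
  ∀ (m n : ℕ) (A : Matrix (Fin m) (Fin n) ℝ), ∀ c ∈ (run (T m n) (start p A)).support, c.1 = []

/-- The distribution of the output of `p` on input `A` after `t` steps. -/
def outputDist (p : Prog) (t : ℕ) {m n : ℕ} (A : Matrix (Fin m) (Fin n) ℝ) : PMF (Fin n → ℝ) :=
  (run t (start p A)).map (output n)

end RealRAM

/-- Colorings: the vectors with all entries in `{1, -1}`. -/
def IsColoring {n : ℕ} (x : Fin n → ℝ) : Prop := ∀ j, x j = 1 ∨ x j = -1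

end

/-!
The bound holds because a deterministic walk in the cube `[-1, 1]ⁿ` attains it; a program that tosses
no coin is a randomized program whose output has probability one.  All quantities below arise
from the input by the four arithmetic operations and comparisons, and the constants are natural
numbers, so the machine can follow the walk exactly.

*The walk.*  Let `s` be the largest square of an entry of `A`, let `p` be the least number with
`m ≤ 2 ^ p`, and let `b = A x`.  The walk starts at `x = 0` and controls the potential
`∑ i, (b i ^ 2 + s) ^ p`.  A coordinate is alive while `x j ^ 2 < 1 - 1 / n`.  As long as at least
three are alive, the walk makes a step of maximum norm `1 / (4 m n)` in the alive coordinates that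
does not decrease `‖x‖²` to first order and does not change the potential to first order
(`IsGoodStep`).  The second-order change of the potential is governed by the quadratic form
`M = Aᵀ W A` with the weights `W i = (b i ^ 2 + s) ^ (p - 1)`, so a direction `y` is needed in which
this form is small.

*Where the determinants enter.*  Gaussian elimination on `M` with complete pivoting is run for `k`
rounds, where `k + 2` coordinates are alive (`Elim`).  The pivots decrease, and their product is the
principal minor of `M` on the used columns (`Elim.det_cons`), so the form at each of the two
remaining columns is at most the `k`-th root of this minor.  By Cauchy–Binet the minor is at most
`(∑ W) ^ k * detLB A ^ (2 * k) / k!` (`det_gram_le`); hence the form is at most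
`e * (∑ W) * detLB A ^ 2 / k` there (`le_of_pow_le_det`).  A combination of the two columns with
coefficients at most `1` is orthogonal to the gradient and still has a small value of the form
(`Elim.exists_kernel_bound`).

*The bound.*  By Bernoulli's inequality a step `d` increases the power mean of the numbers
`b i ^ 2 + s` by `O(p * detLB A ^ 2 * ‖d‖² / k)`.  Both `‖d‖²` and `k` are measured by the slack
`U = ∑ j, (1 - x j ^ 2)`, which drops by at least `‖d‖²` and is at most `k + 3`.  So the increments
add up like `∫ dU / U`, to `O(p * log n * detLB A ^ 2)` (`IsGoodStep.progress`), and since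
`m ≤ 2 ^ p` the maximum of `b i ^ 2` is at most twice the power mean.  As `U` drops by at least
`1 / (4 m n) ^ 2` in each round, after `n * (4 m n) ^ 2` rounds at most two coordinates are alive, and
rounding to signs costs at most `3 * detLB A` (`abs_rowDot_sign_le`).

*The program.*  Its loops are `for` loops, which are verified with a Hoare logic (`RealRAM.Halts`).
As every loop makes at most polynomially many rounds, the running time is read off from the text of
the program (`RealRAM.Prog.cost`, `RealRAM.Prog.cost_le`).
-/

open Finset

namespace RealRAM

/-! ### A program logic for runs without coin tosses -/

/-- `Exec p s t s'`: started in memory `s`, the program `p` halts after `t` steps in memory `s'`,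
without tossing a coin. -/
inductive Exec : Prog → Memory → ℕ → Memory → Prop
  | skip (s) : Exec .skip s 1 s
  | setIdx (x e s) : Exec (.setIdx x e) s 1 (s.setIdx x (e.eval s))
  | setArr (a i j e s) :
      Exec (.setArr a i j e) s 1 (s.setArr a (i.eval s) (j.eval s) (e.eval s))
  | seq {p q s s₁ s₂ t₁ t₂} (hp : Exec p s t₁ s₁) (hq : Exec q s₁ t₂ s₂) :
      Exec (.seq p q) s (t₁ + t₂ + 1) s₂
  | branch_pos {b p q s s₁ t} (hb : b.Holds s) (hp : Exec p s t s₁) :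
      Exec (.branch b p q) s (t + 1) s₁
  | branch_neg {b p q s s₁ t} (hb : ¬ b.Holds s) (hq : Exec q s t s₁) :
      Exec (.branch b p q) s (t + 1) s₁
  | loop_pos {b p s s₁ s₂ t₁ t₂} (hb : b.Holds s) (hp : Exec p s t₁ s₁)
      (hl : Exec (.loop b p) s₁ t₂ s₂) : Exec (.loop b p) s (t₁ + t₂ + 1) s₂
  | loop_neg {b p s} (hb : ¬ b.Holds s) : Exec (.loop b p) s 1 s

/-- The relation `Exec` is sound for the step-by-step semantics of the machine. -/
theorem Exec.run_add {p : Prog} {s s' : Memory} {t : ℕ} (h : Exec p s t s') :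
    ∀ (k : List Prog) (T : ℕ), run (T + t) (p :: k, s) = run T (k, s') := by
  induction h with
  | skip s => intro k T; simp [run, step]
  | setIdx x e s => intro k T; simp [run, step]
  | setArr a i j e s => intro k T; simp [run, step]
  | @seq p q s s₁ s₂ t₁ t₂ hp hq ihp ihq =>
    intro k T
    rw [← Nat.add_assoc, run, step, PMF.pure_bind, Nat.add_comm _ t₂, ← Nat.add_assoc, ihp, ihq]
  | branch_pos hb hp ih =>
    intro k T
    rw [← Nat.add_assoc, run, step, PMF.pure_bind, if_pos hb, ih]
  | branch_neg hb hp ih =>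
    intro k T
    rw [← Nat.add_assoc, run, step, PMF.pure_bind, if_neg hb, ih]
  | @loop_pos b p s s₁ s₂ t₁ t₂ hb hp hl ihp ihl =>
    intro k T
    rw [← Nat.add_assoc, run, step, PMF.pure_bind, if_pos hb, Nat.add_comm _ t₂, ← Nat.add_assoc,
      ihp, ihl]
  | loop_neg hb => intro k T; simp [run, step, hb]

theorem run_halted (T : ℕ) (s : Memory) : run T ([], s) = PMF.pure ([], s) := by
  induction T with
  | zero => rfl
  | succ T ih => simp [run, step, ih]

theorem Exec.run_eq {p : Prog} {s s' : Memory} {t T : ℕ} (h : Exec p s t s') (hT : t ≤ T) :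
    run T ([p], s) = PMF.pure ([], s') := by
  obtain ⟨d, rfl⟩ := Nat.exists_eq_add_of_le' hT
  rw [h.run_add, run_halted]

/-- Whether the program `p` contains an assignment to array `a`. -/
def Prog.writesArr (a : ℕ) : Prog → Bool
  | .skip => false
  | .setIdx _ _ => false
  | .setArr b _ _ _ => a == b
  | .coin _ => false
  | .seq p q => p.writesArr a || q.writesArr a
  | .branch _ p q => p.writesArr a || q.writesArr a
  | .loop _ p => p.writesArr a

/-- Whether the program `p` contains an assignment to the integer register `x`. -/
def Prog.writesIdx (x : ℕ) : Prog → Bool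
  | .skip => false
  | .setIdx y _ => x == y
  | .setArr _ _ _ _ => false
  | .coin y => x == y
  | .seq p q => p.writesIdx x || q.writesIdx x
  | .branch _ p q => p.writesIdx x || q.writesIdx x
  | .loop _ p => p.writesIdx x

/-- The memories `s` and `s'` agree wherever `p` does not write. -/
structure Frame (p : Prog) (s s' : Memory) : Prop where
  arr : ∀ a, p.writesArr a = false → s'.arr a = s.arr a
  idx : ∀ x, p.writesIdx x = false → s'.idx x = s.idx x

theorem Frame.refl (p : Prog) (s : Memory) : Frame p s s := ⟨fun _ _ => rfl, fun _ _ => rfl⟩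

theorem Frame.trans {p : Prog} {s₁ s₂ s₃ : Memory} (h : Frame p s₁ s₂) (h' : Frame p s₂ s₃) :
    Frame p s₁ s₃ :=
  ⟨fun a ha => (h'.arr a ha).trans (h.arr a ha), fun a ha => (h'.idx a ha).trans (h.idx a ha)⟩

theorem Frame.mono {p q : Prog} {s s' : Memory} (h : Frame p s s')
    (ha : ∀ a, q.writesArr a = false → p.writesArr a = false)
    (hx : ∀ a, q.writesIdx a = false → p.writesIdx a = false) : Frame q s s' :=
  ⟨fun a h' => h.arr a (ha a h'), fun a h' => h.idx a (hx a h')⟩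

theorem Frame.setIdx {p : Prog} {s s' : Memory} (h : Frame p s s') {x v : ℕ}
    (hx : p.writesIdx x = true) : Frame p s (s'.setIdx x v) := by
  refine ⟨h.arr, fun y hy => ?_⟩
  have : y ≠ x := by rintro rfl; simp [hx] at hy
  simpa [Memory.setIdx, this] using h.idx y hy

theorem Exec.frame {p : Prog} {s s' : Memory} {t : ℕ} (h : Exec p s t s') : Frame p s s' := by
  induction h with
  | skip s => exact Frame.refl _ _
  | setIdx x e s => exact (Frame.refl _ _).setIdx (by simp [Prog.writesIdx])
  | setArr a i j e s =>
    refine ⟨fun b hb => ?_, fun _ _ => rfl⟩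
    have : b ≠ a := by simpa [Prog.writesArr] using hb
    funext k l
    simp [Memory.setArr, this]
  | seq hp hq ihp ihq =>
    exact (ihp.mono (by simp +contextual [Prog.writesArr])
      (by simp +contextual [Prog.writesIdx])).trans
      (ihq.mono (by simp +contextual [Prog.writesArr]) (by simp +contextual [Prog.writesIdx]))
  | branch_pos hb hp ih =>
    exact ih.mono (by simp +contextual [Prog.writesArr]) (by simp +contextual [Prog.writesIdx])
  | branch_neg hb hp ih =>
    exact ih.mono (by simp +contextual [Prog.writesArr]) (by simp +contextual [Prog.writesIdx])
  | loop_pos hb hp hl ihp ihl =>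
    exact (ihp.mono (by simp [Prog.writesArr]) (by simp [Prog.writesIdx])).trans ihl
  | loop_neg hb => exact Frame.refl _ _

/-- A bound on the number of steps of `p` when each loop in it makes at most `S` rounds. -/
def Prog.cost (S : ℕ) : Prog → ℕ
  | .skip => 1
  | .setIdx _ _ => 1
  | .setArr _ _ _ _ => 1
  | .coin _ => 1
  | .seq p q => p.cost S + q.cost S + 1
  | .branch _ p q => p.cost S + q.cost S + 1
  | .loop _ p => S * (p.cost S + 1) + 1

/-- `p.cost S` grows polynomially with `S`. -/
theorem Prog.cost_le (p : Prog) : ∃ K : ℕ, ∀ S, p.cost S ≤ K * (S + 1) ^ K := by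
  have mono : ∀ {K K' : ℕ} (S : ℕ), K ≤ K' → K * (S + 1) ^ K ≤ K' * (S + 1) ^ K' :=
    fun S h => Nat.mul_le_mul h (Nat.pow_le_pow_right (Nat.succ_pos S) h)
  have pair : ∀ p q : Prog, (∃ K : ℕ, ∀ S, p.cost S ≤ K * (S + 1) ^ K) →
      (∃ K : ℕ, ∀ S, q.cost S ≤ K * (S + 1) ^ K) →
      ∃ K : ℕ, ∀ S, p.cost S + q.cost S + 1 ≤ K * (S + 1) ^ K := by
    rintro p q ⟨K, hK⟩ ⟨L, hL⟩
    refine ⟨K + L + 1, fun S => ?_⟩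
    have h1 : (S + 1) ^ K ≤ (S + 1) ^ (K + L + 1) :=
      Nat.pow_le_pow_right (Nat.succ_pos S) (by omega)
    have h2 : (S + 1) ^ L ≤ (S + 1) ^ (K + L + 1) :=
      Nat.pow_le_pow_right (Nat.succ_pos S) (by omega)
    have h3 : 1 ≤ (S + 1) ^ (K + L + 1) := Nat.one_le_pow _ _ (Nat.succ_pos S)
    calc p.cost S + q.cost S + 1 ≤ K * (S + 1) ^ K + L * (S + 1) ^ L + 1 := by
          gcongr
          · exact hK S
          · exact hL S
      _ ≤ K * (S + 1) ^ (K + L + 1) + L * (S + 1) ^ (K + L + 1) + (S + 1) ^ (K + L + 1) := by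
          gcongr
      _ = _ := by ring
  induction p with
  | skip => exact ⟨1, fun S => by simp [Prog.cost]⟩
  | setIdx x e => exact ⟨1, fun S => by simp [Prog.cost]⟩
  | setArr a i j e => exact ⟨1, fun S => by simp [Prog.cost]⟩
  | coin x => exact ⟨1, fun S => by simp [Prog.cost]⟩
  | seq p q hp hq => exact pair p q hp hq
  | branch b p q hp hq => exact pair p q hp hq
  | loop b p hp =>
    obtain ⟨K, hK⟩ := hp
    refine ⟨K + 2, fun S => ?_⟩
    have h1 : 1 ≤ (S + 1) ^ (K + 1) := Nat.one_le_pow _ _ (Nat.succ_pos S)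
    have h2 : (S + 1) ^ K ≤ (S + 1) ^ (K + 1) :=
      Nat.pow_le_pow_right (Nat.succ_pos S) (by omega)
    calc S * (p.cost S + 1) + 1 ≤ S * (K * (S + 1) ^ K + 1) + 1 := by
          gcongr
          exact hK S
      _ ≤ S * (K * (S + 1) ^ (K + 1) + (S + 1) ^ (K + 1)) + (S + 1) ^ (K + 1) := by
          gcongr
      _ ≤ (K + 2) * (S + 1) ^ (K + 2) := by
          rw [pow_succ (S + 1) (K + 1)]
          generalize (S + 1) ^ (K + 1) = X
          nlinarith [Nat.zero_le (S * X), Nat.zero_le (K * X), Nat.zero_le X]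

/-- `Halts S p s Q`: started in `s`, the program `p` halts in a memory that satisfies `Q`, and it
does so within the time that is allotted to loops of at most `S` rounds. -/
def Halts (S : ℕ) (p : Prog) (s : Memory) (Q : Memory → Prop) : Prop :=
  ∃ t s', Exec p s t s' ∧ t ≤ p.cost S ∧ Q s'

namespace Halts

variable {S : ℕ} {s : Memory} {Q R : Memory → Prop}

/-- The postcondition may be weakened with the help of the frame. -/
theorem imp {p : Prog} (h : Halts S p s Q) (hQ : ∀ s', Frame p s s' → Q s' → R s') :
    Halts S p s R := by
  obtain ⟨t, s', h, ht, hs⟩ := h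
  exact ⟨t, s', h, ht, hQ s' h.frame hs⟩

theorem skip (h : Q s) : Halts S .skip s Q := ⟨1, s, .skip s, le_rfl, h⟩

theorem setIdx {x : ℕ} {e : IExpr} (h : Q (s.setIdx x (e.eval s))) :
    Halts S (.setIdx x e) s Q := ⟨1, _, .setIdx x e s, le_rfl, h⟩

theorem setArr {a : ℕ} {i j : IExpr} {e : RExpr}
    (h : Q (s.setArr a (i.eval s) (j.eval s) (e.eval s))) :
    Halts S (.setArr a i j e) s Q := ⟨1, _, .setArr a i j e s, le_rfl, h⟩

theorem seq {p q : Prog} (h : Halts S p s fun s' => Halts S q s' Q) :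
    Halts S (.seq p q) s Q := by
  obtain ⟨t, s', h, ht, t', s'', h', ht', hs⟩ := h
  exact ⟨_, _, .seq h h', by simp only [Prog.cost]; omega, hs⟩

theorem branch {b : Test} {p q : Prog} (hp : b.Holds s → Halts S p s Q)
    (hq : ¬ b.Holds s → Halts S q s Q) : Halts S (.branch b p q) s Q := by
  by_cases hb : b.Holds s
  · obtain ⟨t, s', h, ht, hs⟩ := hp hb
    exact ⟨_, _, .branch_pos hb h, by simp only [Prog.cost]; omega, hs⟩
  · obtain ⟨t, s', h, ht, hs⟩ := hq hb
    exact ⟨_, _, .branch_neg hb h, by simp only [Prog.cost]; omega, hs⟩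

end Halts

/-- `for x < e do body`. -/
def Prog.forLt (x : ℕ) (e : IExpr) (body : Prog) : Prog :=
  .seq (.setIdx x (.lit 0))
    (.loop (.iLt (.reg x) e) (.seq body (.setIdx x (.add (.reg x) (.lit 1)))))

/-- Whether the integer expression reads a register that `p` writes. -/
def IExpr.readsFrom (p : Prog) : IExpr → Bool
  | .lit _ => false
  | .reg x => p.writesIdx x
  | .add e f => e.readsFrom p || f.readsFrom p
  | .sub e f => e.readsFrom p || f.readsFrom p

theorem Frame.eval_eq {p : Prog} {s s' : Memory} (h : Frame p s s') :
    ∀ {e : IExpr}, e.readsFrom p = false → e.eval s' = e.eval s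
  | .lit _, _ => rfl
  | .reg x, hx => h.idx x hx
  | .add e f, hx => by
    simp only [IExpr.readsFrom, Bool.or_eq_false_iff] at hx
    simp [IExpr.eval, h.eval_eq hx.1, h.eval_eq hx.2]
  | .sub e f, hx => by
    simp only [IExpr.readsFrom, Bool.or_eq_false_iff] at hx
    simp [IExpr.eval, h.eval_eq hx.1, h.eval_eq hx.2]

/-- The rule for `for` loops.  The invariant `I i` holds after `i` rounds. -/
theorem Halts.forLt {S : ℕ} {s : Memory} {Q : Memory → Prop} {x : ℕ} {e : IExpr} {body : Prog}
    (I : ℕ → Memory → Prop) (hx : body.writesIdx x = false)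
    (he : e.readsFrom (.forLt x e body) = false) (hS : e.eval s ≤ S)
    (h0 : I 0 (s.setIdx x 0))
    (hb : ∀ i < e.eval s, ∀ s', Frame (.forLt x e body) s s' → s'.idx x = i → I i s' →
      Halts S body s' fun s'' => I (i + 1) (s''.setIdx x (i + 1)))
    (hQ : ∀ s', Frame (.forLt x e body) s s' → I (e.eval s) s' → Q s') :
    Halts S (.forLt x e body) s Q := by
  have hwx : (Prog.forLt x e body).writesIdx x = true := by simp [Prog.forLt, Prog.writesIdx]
  have key : ∀ d i s', i + d = e.eval s → Frame (.forLt x e body) s s' → s'.idx x = i →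
      I i s' → ∃ t s'', Exec (.loop (.iLt (.reg x) e)
        (.seq body (.setIdx x (.add (.reg x) (.lit 1))))) s' t s'' ∧
        t ≤ d * (body.cost S + 3) + 1 ∧ Q s'' := by
    intro d
    induction d with
    | zero =>
      intro i s' hi hF hs hI
      refine ⟨1, s', .loop_neg ?_, by omega, hQ s' hF ?_⟩
      · simp only [Test.Holds, IExpr.eval, hF.eval_eq he, hs]
        omega
      · rwa [← hi]
    | succ d ih =>
      intro i s' hi hF hs hI
      obtain ⟨t, s₁, h1, ht, hs1⟩ := hb i (by omega) s' hF hs hI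
      have hs1x : s₁.idx x = i := (h1.frame.idx x hx).trans hs
      have hF1 : Frame (.forLt x e body) s (s₁.setIdx x (i + 1)) :=
        (hF.trans (h1.frame.mono (by simp +contextual [Prog.forLt, Prog.writesArr])
          (by simp +contextual [Prog.forLt, Prog.writesIdx]))).setIdx hwx
      obtain ⟨t', s₂, h2, ht', hs2⟩ := ih (i + 1) (s₁.setIdx x (i + 1)) (by omega) hF1
        (by simp [Memory.setIdx]) hs1
      have hset := Exec.setIdx x (.add (.reg x) (.lit 1)) s₁
      simp only [IExpr.eval, hs1x] at hset
      refine ⟨_, s₂, .loop_pos ?_ (.seq h1 hset) h2, ?_, hs2⟩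
      · simp only [Test.Holds, IExpr.eval, hF.eval_eq he, hs]
        omega
      · rw [Nat.add_mul]
        omega
  obtain ⟨t, s', h, ht, hs⟩ := key (e.eval s) 0 (s.setIdx x 0) (by omega)
    ((Frame.refl _ s).setIdx hwx) (by simp [Memory.setIdx]) h0
  refine ⟨_, s', .seq (.setIdx x (.lit 0) s) h, ?_, hs⟩
  have : e.eval s * (body.cost S + 3) ≤ S * (body.cost S + 3) := Nat.mul_le_mul_right _ hS
  simp only [Prog.forLt, Prog.cost]
  have e1 : body.cost S + 1 + 1 + 1 = body.cost S + 3 := rfl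
  rw [e1]
  omega

end RealRAM

/-! ### Determinants of weighted Gram matrices -/

/-- A form of the Cauchy–Binet formula.  Expanding the determinant in its rows gives a sum over
all maps `f` into the row indices; averaging over the permutations of the columns turns each
summand into a square. -/
theorem factorial_mul_det_weighted_gram {ι κ : Type*} [Fintype ι] [Fintype κ] [DecidableEq κ]
    (B : Matrix ι κ ℝ) (w : ι → ℝ) :
    ((Fintype.card κ).factorial : ℝ) *
        (Matrix.of fun a b => ∑ i, w i * B i a * B i b : Matrix κ κ ℝ).det =
      ∑ f : κ → ι, (∏ a, w (f a)) * (B.submatrix f id).det ^ 2 := by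
  classical
  have h1 : (Matrix.of fun a b => ∑ i, w i * B i a * B i b : Matrix κ κ ℝ).det =
      ∑ f : κ → ι, (∏ a, w (f a) * B (f a) a) * (B.submatrix f id).det := by
    have h := (Matrix.detRowAlternating (n := κ) (R := ℝ)).toMultilinearMap.map_sum
      (fun a i => (w i * B i a) • B i)
    have e : (fun a => ∑ i, (w i * B i a) • B i) =
        (Matrix.of fun a b => ∑ i, w i * B i a * B i b : Matrix κ κ ℝ) := by
      ext a b
      simp [Finset.sum_apply]
    rw [e] at h
    refine h.trans (Finset.sum_congr rfl fun f _ => ?_)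
    rw [MultilinearMap.map_smul_univ]
    rfl
  have h2 : ∀ σ : Equiv.Perm κ,
      ∑ f : κ → ι, (∏ a, w (f a) * B (f a) a) * (B.submatrix f id).det =
      ∑ f : κ → ι, (∏ a, w (f a)) * ((Equiv.Perm.sign σ : ℤ) * ∏ a, B (f (σ a)) a) *
        (B.submatrix f id).det := by
    intro σ
    rw [← (Equiv.arrowCongr σ (Equiv.refl ι)).symm.sum_comp]
    refine Finset.sum_congr rfl fun f _ => ?_
    have e1 : B.submatrix ((Equiv.arrowCongr σ (Equiv.refl ι)).symm f) id =
        (B.submatrix f id).submatrix σ id := rfl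
    have e2 : ∀ a, (Equiv.arrowCongr σ (Equiv.refl ι)).symm f a = f (σ a) := fun a => rfl
    rw [e1, Matrix.det_permute]
    simp only [e2, Finset.prod_mul_distrib, Equiv.prod_comp σ fun a => w (f a)]
    ring
  have h3 : ∀ f : κ → ι, ∑ σ : Equiv.Perm κ, (∏ a, w (f a)) *
      ((Equiv.Perm.sign σ : ℤ) * ∏ a, B (f (σ a)) a) * (B.submatrix f id).det =
      (∏ a, w (f a)) * (B.submatrix f id).det ^ 2 := by
    intro f
    rw [← Finset.sum_mul, ← Finset.mul_sum, sq, ← mul_assoc]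
    congr 2
    rw [Matrix.det_apply']
    rfl
  rw [h1]
  simp_rw [← h3]
  rw [Finset.sum_comm, ← Fintype.card_perm, ← nsmul_eq_mul, ← Finset.card_univ]
  rw [Finset.sum_congr rfl fun σ _ => (h2 σ).symm, Finset.sum_const]

theorem detLB_nonneg {m n : ℕ} (A : Matrix (Fin m) (Fin n) ℝ) : 0 ≤ detLB A := by
  refine Real.sSup_nonneg ?_
  rintro r ⟨k, -, f, g, rfl⟩
  positivity

theorem bddAbove_detValues {m n : ℕ} (A : Matrix (Fin m) (Fin n) ℝ) :
    BddAbove (detValues A) := by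
  refine Set.Finite.bddAbove (Set.Finite.subset (Set.finite_range
    (fun q : Σ k : Fin (m + 1), (Fin k ↪o Fin m) × (Fin k ↪o Fin n) =>
      |(A.submatrix q.2.1 q.2.2).det| ^ (1 / ((q.1 : ℕ) : ℝ)))) ?_)
  rintro r ⟨k, -, f, g, rfl⟩
  have hk : k ≤ m := by simpa using Fintype.card_le_of_embedding f.toEmbedding
  exact ⟨⟨⟨k, by omega⟩, f, g⟩, rfl⟩

theorem exists_orderEmb_of_injective {k m : ℕ} {f : Fin k → Fin m} (hf : f.Injective) :
    ∃ (φ : Fin k ↪o Fin m) (σ : Equiv.Perm (Fin k)), f = φ ∘ σ := by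
  refine ⟨OrderEmbedding.ofStrictMono (f ∘ Tuple.sort f)
    ((Tuple.monotone_sort f).strictMono_of_injective (hf.comp (Tuple.sort f).injective)),
    (Tuple.sort f).symm, ?_⟩
  ext i
  simp

/-- Rows and columns may be listed in any order, and with repetitions. -/
theorem abs_det_submatrix_le_detLB_pow {m n k : ℕ} (A : Matrix (Fin m) (Fin n) ℝ)
    (f : Fin k → Fin m) (g : Fin k → Fin n) :
    |(A.submatrix f g).det| ≤ detLB A ^ k := by
  have h0 := detLB_nonneg A
  by_cases hf : f.Injective
  · by_cases hg : g.Injective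
    · obtain ⟨φ, σ, rfl⟩ := exists_orderEmb_of_injective hf
      obtain ⟨ψ, ρ, rfl⟩ := exists_orderEmb_of_injective hg
      rcases Nat.eq_zero_or_pos k with rfl | hk
      · simp
      have e : |(A.submatrix (φ ∘ σ) (ψ ∘ ρ)).det| = |(A.submatrix φ ψ).det| :=
        Matrix.abs_det_submatrix_equiv_equiv σ ρ (A.submatrix φ ψ)
      have h : |(A.submatrix φ ψ).det| ^ (1 / (k : ℝ)) ≤ detLB A :=
        le_csSup (bddAbove_detValues A) ⟨k, hk, φ, ψ, rfl⟩
      rw [e]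
      calc |(A.submatrix φ ψ).det|
          = (|(A.submatrix φ ψ).det| ^ (1 / (k : ℝ))) ^ k := by
            rw [one_div, Real.rpow_inv_natCast_pow (abs_nonneg _) hk.ne']
        _ ≤ _ := pow_le_pow_left₀ (by positivity) h k
    · obtain ⟨i, j, hij, hne⟩ : ∃ i j, g i = g j ∧ i ≠ j := by
        simpa [Function.Injective] using hg
      rw [Matrix.det_zero_of_column_eq hne fun l => by simp [hij]]
      simpa using pow_nonneg h0 k
  · obtain ⟨i, j, hij, hne⟩ : ∃ i j, f i = f j ∧ i ≠ j := by
      simpa [Function.Injective] using hf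
    rw [Matrix.det_zero_of_row_eq hne (by ext l; simp [hij])]
    simpa using pow_nonneg h0 k

/-! ### Vectors and matrices with indices in `ℕ`

The arrays of the machine are indexed by natural numbers, and so are the objects in the analysis
of the algorithm.  The numbers of rows and columns are separate arguments. -/

/-- Entry `i` of the product `B y`. -/
def rowDot (B : ℕ → ℕ → ℝ) (n : ℕ) (y : ℕ → ℝ) (i : ℕ) : ℝ := ∑ l ∈ range n, B i l * y l

/-- The weighted Gram matrix `Aᵀ W A` of the columns of `A`. -/
def gram (A : ℕ → ℕ → ℝ) (w : ℕ → ℝ) (m : ℕ) (j l : ℕ) : ℝ :=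
  ∑ i ∈ range m, w i * A i j * A i l

theorem rowDot_sub_mul (B : ℕ → ℕ → ℝ) (n : ℕ) (y z : ℕ → ℝ) (c : ℝ) (i : ℕ) :
    rowDot B n (fun l => y l - c * z l) i = rowDot B n y i - c * rowDot B n z i := by
  simp only [rowDot, mul_sub, sum_sub_distrib, mul_sum]
  congr 1
  exact sum_congr rfl fun l _ => by ring

theorem rowDot_add (B : ℕ → ℕ → ℝ) (n : ℕ) (y z : ℕ → ℝ) (i : ℕ) :
    rowDot B n (fun l => y l + z l) i = rowDot B n y i + rowDot B n z i := by
  simp only [rowDot, mul_add, sum_add_distrib]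

theorem rowDot_mul (B : ℕ → ℕ → ℝ) (n : ℕ) (y : ℕ → ℝ) (c : ℝ) (i : ℕ) :
    rowDot B n (fun l => c * y l) i = c * rowDot B n y i := by
  simp only [rowDot, mul_sum]
  exact sum_congr rfl fun l _ => by ring

theorem rowDot_congr {B : ℕ → ℕ → ℝ} {n : ℕ} {y z : ℕ → ℝ} (h : ∀ l < n, y l = z l) (i : ℕ) :
    rowDot B n y i = rowDot B n z i :=
  sum_congr rfl fun l hl => by rw [h l (mem_range.1 hl)]

theorem sum_mul_rowDot_gram (A : ℕ → ℕ → ℝ) (w : ℕ → ℝ) (m n : ℕ) (y z : ℕ → ℝ) :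
    ∑ l ∈ range n, y l * rowDot (gram A w m) n z l =
      ∑ i ∈ range m, w i * rowDot A n y i * rowDot A n z i := by
  simp only [rowDot, gram, mul_sum, sum_mul]
  rw [sum_congr rfl fun l _ => sum_comm, sum_comm]
  refine sum_congr rfl fun i _ => ?_
  rw [sum_comm]
  exact sum_congr rfl fun l _ => sum_congr rfl fun l' _ => by ring

/-- If all `k × k` minors are at most `lam ^ k`, then a principal `k × k` minor of the weighted
Gram matrix is at most `(∑ w) ^ k * lam ^ (2 * k) / k!`. -/
theorem det_gram_le {A : ℕ → ℕ → ℝ} {w : ℕ → ℝ} {m k : ℕ} {lam : ℝ} {τ : Fin k → ℕ}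
    (hw : ∀ i < m, 0 ≤ w i)
    (hdet : ∀ f : Fin k → Fin m, |(Matrix.of fun a b => A (f a) (τ b)).det| ≤ lam ^ k) :
    (Matrix.of fun a b => gram A w m (τ a) (τ b)).det ≤
      (∑ i ∈ range m, w i) ^ k * lam ^ (2 * k) / k.factorial := by
  have h := factorial_mul_det_weighted_gram
    (Matrix.of fun (i : Fin m) (b : Fin k) => A i (τ b)) (fun i => w i)
  have e : (Matrix.of fun a b => ∑ i : Fin m, w i *
      (Matrix.of fun (i : Fin m) (b : Fin k) => A i (τ b)) i a *
      (Matrix.of fun (i : Fin m) (b : Fin k) => A i (τ b)) i b) =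
      Matrix.of fun a b => gram A w m (τ a) (τ b) := by
    ext a b
    simp [gram, Finset.sum_range]
  rw [e, Fintype.card_fin] at h
  rw [le_div_iff₀ (by positivity), mul_comm, h]
  calc ∑ f : Fin k → Fin m, (∏ a, w (f a)) *
        ((Matrix.of fun (i : Fin m) (b : Fin k) => A i (τ b)).submatrix f id).det ^ 2
      ≤ ∑ f : Fin k → Fin m, (∏ a, w (f a)) * lam ^ (2 * k) := by
        refine sum_le_sum fun f _ => ?_
        refine mul_le_mul_of_nonneg_left ?_ (prod_nonneg fun a _ => hw _ (f a).2)
        rw [← sq_abs, mul_comm 2 k, pow_mul]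
        exact pow_le_pow_left₀ (abs_nonneg _) (hdet f) 2
    _ = (∑ i ∈ range m, w i) ^ k * lam ^ (2 * k) := by
        rw [← sum_mul, Finset.sum_range, sum_pow', ← Fintype.piFinset_univ]

/-! ### Elimination with complete pivoting -/

/-- The state of the elimination on the quadratic form `M = Aᵀ W A` after the pivots
`τ 0, …, τ (r - 1)`.  The columns in `J` are not yet used.  Column `j` of `Y` is a vector
`y_j = e_j + (a combination of the used unit vectors)` with `(M y_j) i = 0` for all used `i`, and
the value `(M y_j) j` of the form at `y_j` is at most the geometric mean of the pivots. -/
structure Elim (A : ℕ → ℕ → ℝ) (w : ℕ → ℝ) (m n : ℕ) (N J : Finset ℕ) {r : ℕ} (τ : Fin r → ℕ)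
    (Y : ℕ → ℕ → ℝ) : Prop where
  lt : ∀ j ∈ N, j < n
  sub : J ⊆ N
  mem : ∀ a, τ a ∈ N
  card : J.card + r = N.card
  diag : ∀ j ∈ J, Y j j = 1
  supp : ∀ j ∈ J, ∀ l < n, l ≠ j → (∀ a, l ≠ τ a) → Y l j = 0
  notMem : ∀ a, τ a ∉ J
  orth : ∀ j ∈ J, ∀ a, rowDot (gram A w m) n (fun l => Y l j) (τ a) = 0
  vol : ∀ j ∈ J, rowDot (gram A w m) n (fun l => Y l j) j ^ r ≤
    (Matrix.of fun a b => gram A w m (τ a) (τ b)).det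

theorem Elim.init {A : ℕ → ℕ → ℝ} {w : ℕ → ℝ} {m n : ℕ} {N : Finset ℕ} {Y : ℕ → ℕ → ℝ}
    (hN : ∀ j ∈ N, j < n) (hY : ∀ l < n, ∀ j < n, Y l j = if l = j then 1 else 0) :
    Elim A w m n N N (Fin.elim0 : Fin 0 → ℕ) Y where
  lt := hN
  sub := Finset.Subset.refl _
  mem := fun a => a.elim0
  card := rfl
  diag := fun j hj => by simp [hY j (hN j hj) j (hN j hj)]
  supp := fun j hj l hl hne _ => by simp [hY l hl j (hN j hj), hne]
  notMem := fun a => a.elim0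
  orth := fun j _ a => a.elim0
  vol := fun j _ => by simp

namespace Elim

variable {A : ℕ → ℕ → ℝ} {w : ℕ → ℝ} {m n : ℕ} {N J : Finset ℕ} {r : ℕ} {τ : Fin r → ℕ}
  {Y : ℕ → ℕ → ℝ}

/-- The inner product of `y_j` with a vector `z` that is orthogonal to the used unit vectors is
read off from a single entry of `M z`. -/
theorem sum_form (h : Elim A w m n N J τ Y) {j : ℕ} (hj : j ∈ J) {z : ℕ → ℝ}
    (hz : ∀ a, rowDot (gram A w m) n z (τ a) = 0) :
    ∑ i ∈ range m, w i * rowDot A n (fun l => Y l j) i * rowDot A n z i =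
      rowDot (gram A w m) n z j := by
  rw [← sum_mul_rowDot_gram, sum_eq_single j]
  · simp [h.diag j hj]
  · intro l hl hne
    by_cases ht : ∃ a, l = τ a
    · obtain ⟨a, rfl⟩ := ht
      simp [hz]
    · simp [h.supp j hj l (mem_range.1 hl) hne (by simpa using ht)]
  · intro hn
    exact absurd (mem_range.2 (h.lt j (h.sub hj))) hn

theorem form_self (h : Elim A w m n N J τ Y) {j : ℕ} (hj : j ∈ J) :
    rowDot (gram A w m) n (fun l => Y l j) j =
      ∑ i ∈ range m, w i * rowDot A n (fun l => Y l j) i ^ 2 := by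
  rw [← h.sum_form hj (h.orth j hj)]
  exact sum_congr rfl fun i _ => by ring

theorem form_nonneg (h : Elim A w m n N J τ Y) (hw : ∀ i < m, 0 ≤ w i) {j : ℕ} (hj : j ∈ J) :
    0 ≤ rowDot (gram A w m) n (fun l => Y l j) j := by
  rw [h.form_self hj]
  exact sum_nonneg fun i hi => mul_nonneg (hw i (mem_range.1 hi)) (sq_nonneg _)

theorem form_comm (h : Elim A w m n N J τ Y) {j t : ℕ} (hj : j ∈ J) (ht : t ∈ J) :
    rowDot (gram A w m) n (fun l => Y l t) j = rowDot (gram A w m) n (fun l => Y l j) t := by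
  rw [← h.sum_form hj (h.orth t ht), ← h.sum_form ht (h.orth j hj)]
  exact sum_congr rfl fun i _ => by ring

/-- If the pivot vanishes, then so does its row, since the form is positive semidefinite.  So
division by zero does no harm in the elimination. -/
theorem form_eq_zero (h : Elim A w m n N J τ Y) (hw : ∀ i < m, 0 ≤ w i) {j t : ℕ} (hj : j ∈ J)
    (ht : t ∈ J) (h0 : rowDot (gram A w m) n (fun l => Y l t) t = 0) :
    rowDot (gram A w m) n (fun l => Y l j) t = 0 := by
  rw [h.form_self ht, sum_eq_zero_iff_of_nonneg
    fun i hi => mul_nonneg (hw i (mem_range.1 hi)) (sq_nonneg _)] at h0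
  rw [← h.sum_form ht (h.orth j hj)]
  refine sum_eq_zero fun i hi => ?_
  rcases mul_eq_zero.1 (h0 i hi) with h1 | h1
  · simp [h1]
  · simp [pow_eq_zero_iff two_ne_zero |>.1 h1]

/-- The pivots multiply up to the principal minor of the used columns, because `y_t` arises from
`e_t` by adding used unit vectors. -/
theorem det_cons (h : Elim A w m n N J τ Y) (hτ : τ.Injective) {t : ℕ} (ht : t ∈ J) :
    (Matrix.of fun a b : Fin (r + 1) => gram A w m ((Fin.cons t τ : Fin (r + 1) → ℕ) a)
        ((Fin.cons t τ : Fin (r + 1) → ℕ) b)).det =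
      rowDot (gram A w m) n (fun l => Y l t) t *
        (Matrix.of fun a b => gram A w m (τ a) (τ b)).det := by
  set G : Matrix (Fin (r + 1)) (Fin (r + 1)) ℝ :=
    Matrix.of fun a b : Fin (r + 1) => gram A w m ((Fin.cons t τ : Fin (r + 1) → ℕ) a)
        ((Fin.cons t τ : Fin (r + 1) → ℕ) b) with hG
  have hdis : ∀ a, τ a ≠ t := fun a e => h.notMem a (e ▸ ht)
  have hinj : (Fin.cons t τ : Fin (r + 1) → ℕ).Injective :=
    Fin.cons_injective_iff.2 ⟨by rintro ⟨a, ha⟩; exact hdis a ha, hτ⟩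
  -- Replacing column `0` by `G * y_t` does not change the determinant.
  have hcol := Matrix.det_updateCol_sum G 0 fun a => Y ((Fin.cons t τ : Fin (r + 1) → ℕ) a) t
  have hent : ∀ k, ∑ a, Y ((Fin.cons t τ : Fin (r + 1) → ℕ) a) t • G k a =
      rowDot (gram A w m) n (fun l => Y l t) ((Fin.cons t τ : Fin (r + 1) → ℕ) k) := by
    intro k
    have hsub : univ.image (Fin.cons t τ : Fin (r + 1) → ℕ) ⊆ range n := by
      intro l hl
      obtain ⟨a, -, rfl⟩ := mem_image.1 hl
      refine mem_range.2 ?_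
      refine Fin.cases ?_ (fun a => ?_) a
      · simpa using h.lt t (h.sub ht)
      · simpa using h.lt _ (h.mem a)
    rw [rowDot, ← sum_subset hsub, sum_image fun a _ b _ hab => hinj hab]
    · exact sum_congr rfl fun a _ => by simp [hG, mul_comm]
    · intro l hl hl'
      rw [h.supp t ht l (mem_range.1 hl), mul_zero]
      · rintro rfl
        exact hl' (mem_image.2 ⟨0, mem_univ _, by simp⟩)
      · rintro a rfl
        exact hl' (mem_image.2 ⟨a.succ, mem_univ _, by simp⟩)
  simp only [hent] at hcol
  simp only [Fin.cons_zero, h.diag t ht, one_smul] at hcol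
  rw [← hcol, Matrix.det_succ_column_zero, Fin.sum_univ_succ, sum_eq_zero]
  · simp only [Fin.val_zero, pow_zero, one_mul, Matrix.updateCol_self, Fin.cons_zero, add_zero]
    congr 2
  · intro a _
    simp [h.orth t ht a]

/-- One round of the elimination, with the largest pivot available. -/
theorem step (h : Elim A w m n N J τ Y) (hτ : τ.Injective) (hw : ∀ i < m, 0 ≤ w i) {t : ℕ}
    (ht : t ∈ J)
    (hmax : ∀ j ∈ J, rowDot (gram A w m) n (fun l => Y l j) j ≤
      rowDot (gram A w m) n (fun l => Y l t) t)
    {Y' : ℕ → ℕ → ℝ}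
    (hY' : ∀ j ∈ J, j ≠ t → ∀ l < n, Y' l j = Y l j -
      rowDot (gram A w m) n (fun l => Y l j) t / rowDot (gram A w m) n (fun l => Y l t) t *
        Y l t) :
    (Fin.cons t τ : Fin (r + 1) → ℕ).Injective ∧
    Elim A w m n N (J.erase t) (Fin.cons t τ : Fin (r + 1) → ℕ) Y' := by
  have hdis : ∀ a, τ a ≠ t := fun a e => h.notMem a (e ▸ ht)
  have hrow : ∀ j ∈ J, j ≠ t → ∀ i, rowDot (gram A w m) n (fun l => Y' l j) i =
      rowDot (gram A w m) n (fun l => Y l j) i -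
      rowDot (gram A w m) n (fun l => Y l j) t / rowDot (gram A w m) n (fun l => Y l t) t *
        rowDot (gram A w m) n (fun l => Y l t) i := by
    intro j hj hjt i
    rw [← rowDot_sub_mul]
    exact rowDot_congr (fun l hl => hY' j hj hjt l hl) i
  refine ⟨Fin.cons_injective_iff.2 ⟨by rintro ⟨a, ha⟩; exact hdis a ha, hτ⟩, h.lt,
    (erase_subset _ _).trans h.sub, ?_, ?_, ?_, ?_, ?_, ?_, ?_⟩
  · intro a
    refine Fin.cases ?_ (fun a => ?_) a
    · simpa using h.sub ht
    · simpa using h.mem a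
  · have := h.card
    have := card_erase_add_one ht
    omega
  · intro j hj
    obtain ⟨hjt, hj⟩ := mem_erase.1 hj
    have hjn := h.lt j (h.sub hj)
    rw [hY' j hj hjt j hjn, h.diag j hj, h.supp t ht j hjn hjt fun a e => h.notMem a (e ▸ hj)]
    simp
  · intro j hj l hl hlj hlτ
    obtain ⟨hjt, hj⟩ := mem_erase.1 hj
    have h0 : l ≠ t := by simpa using hlτ 0
    have h1 : ∀ a, l ≠ τ a := fun a => by simpa using hlτ a.succ
    rw [hY' j hj hjt l hl, h.supp j hj l hl hlj h1, h.supp t ht l hl h0 h1]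
    simp
  · intro a
    refine Fin.cases ?_ (fun a => ?_) a
    · simp
    · simp only [Fin.cons_succ, mem_erase, not_and]
      exact fun _ => h.notMem a
  · intro j hj a
    obtain ⟨hjt, hj⟩ := mem_erase.1 hj
    rw [hrow j hj hjt]
    refine Fin.cases ?_ (fun a => ?_) a
    · rw [Fin.cons_zero]
      by_cases h0 : rowDot (gram A w m) n (fun l => Y l t) t = 0
      · simp [h0, h.form_eq_zero hw hj ht h0]
      · rw [div_mul_cancel₀ _ h0, sub_self]
    · simp [h.orth j hj a, h.orth t ht a]
  · intro j hj
    have hnn : 0 ≤ rowDot (gram A w m) n (fun l => Y' l j) j := by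
      obtain ⟨hjt, hj⟩ := mem_erase.1 hj
      have e : rowDot (gram A w m) n (fun l => Y' l j) j =
          ∑ i ∈ range m, w i * rowDot A n (fun l => Y' l j) i ^ 2 := by
        have hz : ∀ a, rowDot (gram A w m) n (fun l => Y' l j) (τ a) = 0 := fun a => by
          simp [hrow j hj hjt, h.orth j hj a, h.orth t ht a]
        have h1 := h.sum_form hj hz
        have h2 := h.sum_form ht hz
        have h3 : rowDot (gram A w m) n (fun l => Y' l j) t = 0 := by
          rw [hrow j hj hjt]
          by_cases h0 : rowDot (gram A w m) n (fun l => Y l t) t = 0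
          · simp [h0, h.form_eq_zero hw hj ht h0]
          · rw [div_mul_cancel₀ _ h0, sub_self]
        rw [h3] at h2
        rw [← h1]
        have e3 : ∀ i, rowDot A n (fun l => Y' l j) i = rowDot A n (fun l => Y l j) i -
            rowDot (gram A w m) n (fun l => Y l j) t /
              rowDot (gram A w m) n (fun l => Y l t) t * rowDot A n (fun l => Y l t) i := by
          intro i
          rw [← rowDot_sub_mul]
          exact rowDot_congr (fun l hl => hY' j hj hjt l hl) i
        set c := rowDot (gram A w m) n (fun l => Y l j) t /
              rowDot (gram A w m) n (fun l => Y l t) t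
        have h4 : ∑ i ∈ range m, w i * rowDot A n (fun l => Y' l j) i ^ 2 =
            ∑ i ∈ range m, w i * rowDot A n (fun l => Y l j) i *
              rowDot A n (fun l => Y' l j) i -
            c * ∑ i ∈ range m, w i * rowDot A n (fun l => Y l t) i *
              rowDot A n (fun l => Y' l j) i := by
          rw [mul_sum, ← sum_sub_distrib]
          refine sum_congr rfl fun i _ => ?_
          rw [sq]
          nth_rewrite 1 [e3 i]
          ring
        rw [h4, h2]
        ring
      rw [e]
      exact sum_nonneg fun i hi => mul_nonneg (hw i (mem_range.1 hi)) (sq_nonneg _)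
    obtain ⟨hjt, hj⟩ := mem_erase.1 hj
    have hle : rowDot (gram A w m) n (fun l => Y' l j) j ≤
        rowDot (gram A w m) n (fun l => Y l t) t := by
      refine le_trans ?_ (hmax j hj)
      rw [hrow j hj hjt, h.form_comm hj ht, div_mul_eq_mul_div]
      have := div_nonneg (mul_self_nonneg (rowDot (gram A w m) n (fun l => Y l j) t))
        (h.form_nonneg hw ht)
      linarith
    rw [h.det_cons hτ ht, pow_succ, mul_comm]
    exact mul_le_mul hle ((pow_le_pow_left₀ hnn hle r).trans (h.vol t ht)) (pow_nonneg hnn r)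
      (h.form_nonneg hw ht)

/-- The last elimination step, with respect to a linear functional `u` instead of the form: as
the pivot has the largest value of `|u|`, the coefficient is at most `1`, and the value of the
form grows by a factor of `4` at most. -/
theorem exists_kernel_bound (h : Elim A w m n N J τ Y) (hw : ∀ i < m, 0 ≤ w i) {u : ℕ → ℝ}
    {j t : ℕ} (hj : j ∈ J) (ht : t ∈ J) (hjt : j ≠ t)
    (hmax : (∑ l ∈ range n, u l * Y l j) ^ 2 ≤ (∑ l ∈ range n, u l * Y l t) ^ 2)
    {y : ℕ → ℝ} (hy : ∀ l < n, y l = Y l j -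
      (∑ l ∈ range n, u l * Y l j) / (∑ l ∈ range n, u l * Y l t) * Y l t) :
    y j = 1 ∧ (∀ l < n, l ∉ N → y l = 0) ∧ ∑ l ∈ range n, u l * y l = 0 ∧
    ∃ μ : ℝ, 0 ≤ μ ∧ μ ^ r ≤ (Matrix.of fun a b => gram A w m (τ a) (τ b)).det ∧
      ∑ i ∈ range m, w i * rowDot A n y i ^ 2 ≤ 4 * μ := by
  set uj := ∑ l ∈ range n, u l * Y l j
  set ut := ∑ l ∈ range n, u l * Y l t
  have hjn := h.lt j (h.sub hj)
  refine ⟨?_, ?_, ?_, max (rowDot (gram A w m) n (fun l => Y l j) j)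
    (rowDot (gram A w m) n (fun l => Y l t) t), le_max_of_le_left (h.form_nonneg hw hj), ?_, ?_⟩
  · rw [hy j hjn, h.diag j hj, h.supp t ht j hjn hjt fun a e => h.notMem a (e ▸ hj)]
    simp
  · intro l hl hlN
    have h1 : ∀ a, l ≠ τ a := fun a e => hlN (e ▸ h.mem a)
    rw [hy l hl, h.supp j hj l hl (fun e => hlN (e ▸ h.sub hj)) h1,
      h.supp t ht l hl (fun e => hlN (e ▸ h.sub ht)) h1]
    simp
  · have e : ∑ l ∈ range n, u l * y l = uj - uj / ut * ut := by
      rw [mul_sum, ← sum_sub_distrib]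
      exact sum_congr rfl fun l hl => by rw [hy l (mem_range.1 hl)]; ring
    rw [e]
    by_cases h0 : ut = 0
    · have : uj = 0 := by
        rw [h0] at hmax
        nlinarith [sq_nonneg uj]
      simp [h0, this]
    · rw [div_mul_cancel₀ _ h0, sub_self]
  · rcases max_choice (rowDot (gram A w m) n (fun l => Y l j) j)
      (rowDot (gram A w m) n (fun l => Y l t) t) with h1 | h1 <;> rw [h1]
    · exact h.vol j hj
    · exact h.vol t ht
  · have hc : (uj / ut) ^ 2 ≤ 1 := by
      rw [div_pow]
      exact div_le_one_of_le₀ hmax (sq_nonneg _)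
    set c := uj / ut
    have e : ∀ i, rowDot A n y i = rowDot A n (fun l => Y l j) i -
        c * rowDot A n (fun l => Y l t) i := by
      intro i
      rw [← rowDot_sub_mul]
      exact rowDot_congr hy i
    calc ∑ i ∈ range m, w i * rowDot A n y i ^ 2
        ≤ ∑ i ∈ range m, (2 * (w i * rowDot A n (fun l => Y l j) i ^ 2) +
            2 * (w i * rowDot A n (fun l => Y l t) i ^ 2)) := by
          refine sum_le_sum fun i hi => ?_
          rw [e i]
          have h1 : (rowDot A n (fun l => Y l j) i - c * rowDot A n (fun l => Y l t) i) ^ 2 ≤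
              2 * rowDot A n (fun l => Y l j) i ^ 2 + 2 * rowDot A n (fun l => Y l t) i ^ 2 := by
            nlinarith [sq_nonneg (rowDot A n (fun l => Y l j) i +
              c * rowDot A n (fun l => Y l t) i),
              mul_le_mul_of_nonneg_right hc (sq_nonneg (rowDot A n (fun l => Y l t) i))]
          have := mul_le_mul_of_nonneg_left h1 (hw i (mem_range.1 hi))
          linarith
      _ = 2 * rowDot (gram A w m) n (fun l => Y l j) j +
            2 * rowDot (gram A w m) n (fun l => Y l t) t := by
          rw [h.form_self hj, h.form_self ht, sum_add_distrib, mul_sum, mul_sum]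
      _ ≤ _ := by
          have h1 := le_max_left (rowDot (gram A w m) n (fun l => Y l j) j)
            (rowDot (gram A w m) n (fun l => Y l t) t)
          have h2 := le_max_right (rowDot (gram A w m) n (fun l => Y l j) j)
            (rowDot (gram A w m) n (fun l => Y l t) t)
          linarith

end Elim

/-! ### The potential -/

/-- The weight of row `i` at the point `x`. -/
def rowWeight (A : ℕ → ℕ → ℝ) (n : ℕ) (s : ℝ) (p : ℕ) (x : ℕ → ℝ) (i : ℕ) : ℝ :=
  (rowDot A n x i ^ 2 + s) ^ (p - 1)

/-- The potential, a regularized `2p`-th power sum of the discrepancies of the rows. -/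
def potential (A : ℕ → ℕ → ℝ) (m n : ℕ) (s : ℝ) (p : ℕ) (x : ℕ → ℝ) : ℝ :=
  ∑ i ∈ range m, (rowDot A n x i ^ 2 + s) ^ p

/-- The gradient of the potential at `x`, up to the factor `2p`. -/
def grad (A : ℕ → ℕ → ℝ) (w : ℕ → ℝ) (m n : ℕ) (x : ℕ → ℝ) (l : ℕ) : ℝ :=
  ∑ i ∈ range m, w i * rowDot A n x i * A i l

/-- The distance of `‖x‖²` from its maximum on the cube. -/
def slack (n : ℕ) (x : ℕ → ℝ) : ℝ := ∑ j ∈ range n, (1 - x j ^ 2)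

open Classical in
/-- The coordinates that are not yet close to `1` or `-1`. -/
noncomputable def alive (n : ℕ) (x : ℕ → ℝ) : Finset ℕ := (range n).filter fun j => x j * x j < 1 - 1 / (n : ℝ)

theorem mem_alive {n : ℕ} {x : ℕ → ℝ} {j : ℕ} :
    j ∈ alive n x ↔ j < n ∧ x j * x j < 1 - 1 / (n : ℝ) := by
  simp [alive]

/-- What one round of the algorithm needs of its step `d`: it moves coordinates in `N` only, each
by at most `δ`, one of them by `δ`; it does not decrease `‖x‖²` to first order and does not change
the potential to first order; and its second-order effect on the potential is bounded by means of
a minor of the weighted Gram matrix of `A`. -/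
structure IsGoodStep (A : ℕ → ℕ → ℝ) (w x : ℕ → ℝ) (m n : ℕ) (N : Finset ℕ) (δ : ℝ)
    (d : ℕ → ℝ) : Prop where
  supp : ∀ l < n, l ∉ N → d l = 0
  le : ∀ l < n, |d l| ≤ δ
  ge : δ ^ 2 ≤ ∑ l ∈ range n, d l ^ 2
  inner : 0 ≤ ∑ l ∈ range n, x l * d l
  lin : ∑ l ∈ range n, grad A w m n x l * d l = 0
  quad : ∃ (τ : Fin (N.card - 2) → ℕ) (μ : ℝ), (∀ a, τ a < n) ∧ 0 ≤ μ ∧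
    μ ^ (N.card - 2) ≤ (Matrix.of fun a b => gram A w m (τ a) (τ b)).det ∧
    ∑ i ∈ range m, w i * rowDot A n d i ^ 2 ≤ 4 * μ * ∑ l ∈ range n, d l ^ 2

/-- A good step from a direction `y`: it is scaled to maximum norm `δ`, and its sign is chosen such
that `‖x‖²` does not decrease to first order.  As `y` has an entry `1`, the bound `4 * μ` for the
form at `y` turns into `4 * μ * ‖d‖²` after scaling. -/
theorem isGoodStep_of_direction {A : ℕ → ℕ → ℝ} {w x : ℕ → ℝ} {m n : ℕ} {N : Finset ℕ} {δ : ℝ}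
    {d y : ℕ → ℝ} {j t : ℕ} {τ : Fin (N.card - 2) → ℕ} {μ : ℝ}
    (hδ : 0 ≤ δ) (hj : j < n) (hyj : y j = 1)
    (hsupp : ∀ l < n, l ∉ N → y l = 0) (hlin : ∑ l ∈ range n, grad A w m n x l * y l = 0)
    (ht : t < n) (hmax : ∀ l < n, y l * y l ≤ y t * y t)
    (hτ : ∀ a, τ a < n) (hμ : 0 ≤ μ)
    (hdet : μ ^ (N.card - 2) ≤ (Matrix.of fun a b => gram A w m (τ a) (τ b)).det)
    (hquad : ∑ i ∈ range m, w i * rowDot A n y i ^ 2 ≤ 4 * μ)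
    (hd : ∀ l < n, d l =
      (if ∑ l ∈ range n, x l * (y l / y t) < 0 then -δ else δ) * (y l / y t)) :
    IsGoodStep A w x m n N δ d := by
  set u := ∑ l ∈ range n, x l * (y l / y t) with hu
  obtain ⟨σ, hσ, hσu, hdσ⟩ : ∃ σ : ℝ, σ ^ 2 = δ ^ 2 ∧ 0 ≤ σ * u ∧
      ∀ l < n, d l = σ * (y l / y t) := by
    by_cases h : u < 0
    · exact ⟨-δ, by ring, by nlinarith, fun l hl => by rw [hd l hl, if_pos h]⟩
    · exact ⟨δ, rfl, mul_nonneg hδ (not_lt.1 h), fun l hl => by rw [hd l hl, if_neg h]⟩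
  have hyt : 1 ≤ y t * y t := by simpa [hyj] using hmax j hj
  have hyt0 : y t ≠ 0 := by rintro h; norm_num [h] at hyt
  set c := σ / y t with hc
  have hdc : ∀ l < n, d l = c * y l := fun l hl => by rw [hdσ l hl, hc]; ring
  have hc2 : c ^ 2 * (y t * y t) = δ ^ 2 := by
    rw [hc, ← hσ]; field_simp
  have hsum : ∑ l ∈ range n, d l ^ 2 = c ^ 2 * ∑ l ∈ range n, y l * y l := by
    rw [mul_sum]
    exact sum_congr rfl fun l hl => by rw [hdc l (mem_range.1 hl)]; ring
  have hone : ∀ i < n, y i * y i ≤ ∑ l ∈ range n, y l * y l := fun i hi =>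
    single_le_sum (f := fun l => y l * y l) (fun l _ => mul_self_nonneg _) (mem_range.2 hi)
  refine ⟨fun l hl hN => by rw [hdc l hl, hsupp l hl hN, mul_zero], fun l hl => ?_, ?_, ?_, ?_,
    τ, μ, hτ, hμ, hdet, ?_⟩
  · refine abs_le_of_sq_le_sq ?_ hδ
    rw [hdc l hl, mul_pow, ← hc2, sq (y l)]
    exact mul_le_mul_of_nonneg_left (hmax l hl) (sq_nonneg c)
  · rw [hsum, ← hc2]
    exact mul_le_mul_of_nonneg_left (hone t ht) (sq_nonneg c)
  · have : ∑ l ∈ range n, x l * d l = σ * u := by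
      rw [hu, mul_sum]
      exact sum_congr rfl fun l hl => by rw [hdσ l (mem_range.1 hl)]; ring
    rw [this]
    exact hσu
  · have : ∑ l ∈ range n, grad A w m n x l * d l =
        c * ∑ l ∈ range n, grad A w m n x l * y l := by
      rw [mul_sum]
      exact sum_congr rfl fun l hl => by rw [hdc l (mem_range.1 hl)]; ring
    rw [this, hlin, mul_zero]
  · have h1 : ∑ i ∈ range m, w i * rowDot A n d i ^ 2 =
        c ^ 2 * ∑ i ∈ range m, w i * rowDot A n y i ^ 2 := by
      rw [mul_sum]
      refine sum_congr rfl fun i _ => ?_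
      rw [rowDot_congr hdc, rowDot_mul]
      ring
    rw [h1, hsum]
    have h2 : (1 : ℝ) ≤ ∑ l ∈ range n, y l * y l := by simpa [hyj] using hone j hj
    calc c ^ 2 * ∑ i ∈ range m, w i * rowDot A n y i ^ 2 ≤ c ^ 2 * (4 * μ) := by gcongr
      _ = 4 * μ * (c ^ 2 * 1) := by ring
      _ ≤ _ := by gcongr

theorem pow_add_le {g e : ℝ} {p : ℕ} (hp : 1 ≤ p) (hg : 0 < g) (he : p * |e| ≤ g) :
    (g + e) ^ p ≤ g ^ p + p * g ^ (p - 1) * e + p ^ 2 * g ^ (p - 1) * (e ^ 2 / g) := by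
  set τ := e / g with hτ
  have hpτ : |p * τ| ≤ 1 := by
    rw [hτ, ← mul_div_assoc, abs_div, abs_mul, Nat.abs_cast, abs_of_pos hg]
    exact div_le_one_of_le₀ he hg.le
  have hτ1 : -1 ≤ τ := by
    have h1 : |τ| ≤ |p * τ| := by
      rw [abs_mul, Nat.abs_cast]
      have : (1 : ℝ) ≤ p := by exact_mod_cast hp
      nlinarith [abs_nonneg τ]
    exact (abs_le.1 (h1.trans hpτ)).1
  have h1 : (1 + τ) ^ p ≤ 1 + p * τ + (p * τ) ^ 2 := by
    calc (1 + τ) ^ p ≤ Real.exp τ ^ p :=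
          pow_le_pow_left₀ (by linarith) (by linarith [Real.add_one_le_exp τ]) p
      _ = Real.exp (p * τ) := (Real.exp_nat_mul τ p).symm
      _ ≤ _ := by linarith [(abs_le.1 (Real.abs_exp_sub_one_sub_id_le hpτ)).2]
  have e1 : e = g * τ := by rw [hτ]; field_simp
  have e2 : g ^ p = g ^ (p - 1) * g := by rw [← pow_succ, Nat.sub_add_cancel hp]
  calc (g + e) ^ p = g ^ p * (1 + τ) ^ p := by rw [← mul_pow, e1]; ring
    _ ≤ g ^ p * (1 + p * τ + (p * τ) ^ 2) := by gcongr
    _ = _ := by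
      rw [e1, e2]
      field_simp

/-- The sum of the weights is controlled by the power mean. -/
theorem sum_pow_sub_one_le {m p : ℕ} {g : ℕ → ℝ} {q : ℝ} (hp : 1 ≤ p) (hq : 0 < q)
    (hg : ∀ i < m, 0 ≤ g i) (h : ∑ i ∈ range m, g i ^ p ≤ m * q ^ p) :
    ∑ i ∈ range m, g i ^ (p - 1) ≤ m * q ^ (p - 1) := by
  obtain ⟨r, rfl⟩ := Nat.exists_eq_add_of_le' hp
  rw [Nat.add_sub_cancel]
  -- By the AM-GM inequality, `(r + 1) * g ^ r * q ≤ r * g ^ (r + 1) + q ^ (r + 1)`.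
  have key : ∀ a : ℝ, 0 ≤ a → (r + 1) * (a ^ r * q) ≤ r * a ^ (r + 1) + q ^ (r + 1) := by
    intro a ha
    rcases ha.eq_or_lt with rfl | ha
    · rcases Nat.eq_zero_or_pos r with rfl | hr
      · simp
      · simp [hr.ne']
        positivity
    · have h1 := one_add_mul_le_pow (a := q / a - 1) (by have := div_pos hq ha; linarith) (r + 1)
      have h2 : a ^ (r + 1) * (1 + ((r + 1 : ℕ) : ℝ) * (q / a - 1)) ≤
          a ^ (r + 1) * (1 + (q / a - 1)) ^ (r + 1) := by gcongr
      have h3 : a ^ (r + 1) * (1 + (q / a - 1)) ^ (r + 1) = q ^ (r + 1) := by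
        rw [add_sub_cancel, ← mul_pow, mul_div_cancel₀ _ ha.ne']
      have h4 : a ^ (r + 1) * (q / a) = a ^ r * q := by
        field_simp
        ring
      rw [h3] at h2
      push_cast at h2
      linear_combination h2 + (-(r + 1 : ℝ)) * h4
  have hs : (r + 1) * q * ∑ i ∈ range m, g i ^ r ≤ (r + 1) * q * (m * q ^ r) := by
    calc (r + 1) * q * ∑ i ∈ range m, g i ^ r = ∑ i ∈ range m, (r + 1) * (g i ^ r * q) := by
          rw [mul_sum]
          exact sum_congr rfl fun i _ => by ring
      _ ≤ ∑ i ∈ range m, (r * g i ^ (r + 1) + q ^ (r + 1)) :=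
          sum_le_sum fun i hi => key _ (hg i (mem_range.1 hi))
      _ = r * ∑ i ∈ range m, g i ^ (r + 1) + m * q ^ (r + 1) := by
          rw [sum_add_distrib, ← mul_sum, sum_const, card_range, nsmul_eq_mul]
      _ ≤ r * (m * q ^ (r + 1)) + m * q ^ (r + 1) := by gcongr
      _ = _ := by ring
  exact le_of_mul_le_mul_left hs (by positivity)

section Progress

variable {A : ℕ → ℕ → ℝ} {w x d : ℕ → ℝ} {m n p : ℕ} {s lam δ : ℝ}

/-- The second-order bound for the potential. -/
theorem potential_add_le (hp : 1 ≤ p) (hs : 0 < s) (hd : ∀ i < m, 3 * p * |rowDot A n d i| ≤ √s)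
    (hlin : ∑ l ∈ range n, grad A (rowWeight A n s p x) m n x l * d l = 0) :
    potential A m n s p (fun l => x l + d l) ≤ potential A m n s p x +
      9 * p ^ 2 * ∑ i ∈ range m, rowWeight A n s p x i * rowDot A n d i ^ 2 := by
  have hp' : (1 : ℝ) ≤ p := by exact_mod_cast hp
  have hl : ∑ i ∈ range m, rowWeight A n s p x i * rowDot A n x i * rowDot A n d i = 0 := by
    rw [← hlin]
    simp only [grad, sum_mul]
    rw [sum_comm]
    refine sum_congr rfl fun i _ => ?_
    rw [rowDot.eq_1 A n d, mul_sum]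
    exact sum_congr rfl fun l _ => by ring
  have hi : ∀ i < m, (rowDot A n (fun l => x l + d l) i ^ 2 + s) ^ p ≤
      (rowDot A n x i ^ 2 + s) ^ p +
        2 * p * (rowWeight A n s p x i * rowDot A n x i * rowDot A n d i) +
        9 * p ^ 2 * (rowWeight A n s p x i * rowDot A n d i ^ 2) := by
    intro i hi
    rw [rowDot_add, rowWeight]
    set b := rowDot A n x i
    set h := rowDot A n d i
    set g := b ^ 2 + s with hg
    have hg0 : 0 < g := by positivity
    have h2 := hd i hi
    have hss : √s ^ 2 = s := Real.sq_sqrt hs.le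
    have habs : |h| ^ 2 = h ^ 2 := sq_abs h
    have h3 : 9 * (p : ℝ) ^ 2 * h ^ 2 ≤ s := by
      rw [← hss, ← habs]
      calc 9 * (p : ℝ) ^ 2 * |h| ^ 2 = (3 * p * |h|) ^ 2 := by ring
        _ ≤ _ := pow_le_pow_left₀ (by positivity) h2 2
    have h4 : h ^ 2 ≤ s := by
      have : (1 : ℝ) ≤ 9 * p ^ 2 := by nlinarith
      nlinarith [sq_nonneg h]
    have h5 : (2 * b * h + h ^ 2) ^ 2 ≤ 8 * g * h ^ 2 := by
      have : (2 * b + h) ^ 2 ≤ 8 * g := by nlinarith [sq_nonneg (2 * b - h)]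
      calc (2 * b * h + h ^ 2) ^ 2 = (2 * b + h) ^ 2 * h ^ 2 := by ring
        _ ≤ _ := by gcongr
    have h6 : p * |2 * b * h + h ^ 2| ≤ g := by
      refine le_of_sq_le_sq ?_ hg0.le
      rw [mul_pow, sq_abs]
      calc (p : ℝ) ^ 2 * (2 * b * h + h ^ 2) ^ 2 ≤ (p : ℝ) ^ 2 * (8 * g * h ^ 2) := by gcongr
        _ ≤ g * (9 * p ^ 2 * h ^ 2) := by nlinarith [sq_nonneg ((p : ℝ) * h)]
        _ ≤ g * g := by
          gcongr
          nlinarith [sq_nonneg b]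
        _ = g ^ 2 := by ring
    have h7 := pow_add_le hp hg0 h6
    have h8 : (2 * b * h + h ^ 2) ^ 2 / g ≤ 8 * h ^ 2 := by
      rw [div_le_iff₀ hg0]
      linarith
    have h9 : g + (2 * b * h + h ^ 2) = (b + h) ^ 2 + s := by rw [hg]; ring
    rw [h9] at h7
    refine h7.trans ?_
    have h10 : (p : ℝ) ^ 2 * g ^ (p - 1) * ((2 * b * h + h ^ 2) ^ 2 / g) ≤
        (p : ℝ) ^ 2 * g ^ (p - 1) * (8 * h ^ 2) := by gcongr
    have h11 : (p : ℝ) * (g ^ (p - 1) * h ^ 2) ≤ p ^ 2 * (g ^ (p - 1) * h ^ 2) := by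
      gcongr
      nlinarith
    linarith
  calc potential A m n s p (fun l => x l + d l)
      ≤ ∑ i ∈ range m, ((rowDot A n x i ^ 2 + s) ^ p +
        2 * p * (rowWeight A n s p x i * rowDot A n x i * rowDot A n d i) +
        9 * p ^ 2 * (rowWeight A n s p x i * rowDot A n d i ^ 2)) :=
        sum_le_sum fun i h => hi i (mem_range.1 h)
    _ = _ := by
      rw [sum_add_distrib, sum_add_distrib, ← mul_sum, ← mul_sum, hl, potential]
      ring

/-- The bound for the largest possible pivots: a geometric mean of `k` pivots is at most
`(∑ w) * lam² * e / k`. -/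
theorem le_of_pow_le_det {k : ℕ} (hk : 1 ≤ k) {τ : Fin k → ℕ} {μ : ℝ} (hw : ∀ i < m, 0 ≤ w i)
    (hlam : 0 ≤ lam)
    (hdet : ∀ f : Fin k → Fin m, |(Matrix.of fun a b => A (f a) (τ b)).det| ≤ lam ^ k)
    (h : μ ^ k ≤ (Matrix.of fun a b => gram A w m (τ a) (τ b)).det) :
    k * μ ≤ Real.exp 1 * lam ^ 2 * ∑ i ∈ range m, w i := by
  have hW : 0 ≤ ∑ i ∈ range m, w i := sum_nonneg fun i hi => hw i (mem_range.1 hi)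
  refine le_of_pow_le_pow_left₀ (n := k) (by omega) (by positivity) ?_
  have h1 := h.trans (det_gram_le hw hdet)
  have h2 := Real.pow_div_factorial_le_exp (x := k) (by positivity) k
  have h3 : Real.exp k = Real.exp 1 ^ k := by rw [← Real.exp_nat_mul, mul_one]
  calc (k * μ) ^ k = (k : ℝ) ^ k * μ ^ k := mul_pow _ _ _
    _ ≤ (k : ℝ) ^ k * ((∑ i ∈ range m, w i) ^ k * lam ^ (2 * k) / k.factorial) := by gcongr
    _ = ((k : ℝ) ^ k / k.factorial) * ((∑ i ∈ range m, w i) ^ k * lam ^ (2 * k)) := by ring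
    _ ≤ Real.exp 1 ^ k * ((∑ i ∈ range m, w i) ^ k * lam ^ (2 * k)) := by
      rw [← h3]
      gcongr
    _ = _ := by ring

/-- A coordinate that is not alive contributes at most `1 / n` to the slack. -/
theorem slack_le (hn : 1 ≤ n) : slack n x ≤ (alive n x).card + 1 := by
  classical
  have hn' : (0 : ℝ) < n := by exact_mod_cast hn
  calc slack n x ≤ ∑ j ∈ range n, ((if j ∈ alive n x then 1 else 0) + 1 / (n : ℝ)) := by
        refine sum_le_sum fun j hj => ?_
        by_cases h : j ∈ alive n x
        · rw [if_pos h]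
          have : 0 < 1 / (n : ℝ) := by positivity
          nlinarith [sq_nonneg (x j)]
        · rw [if_neg h]
          have : ¬ x j * x j < 1 - 1 / (n : ℝ) := fun h' => h (mem_alive.2 ⟨mem_range.1 hj, h'⟩)
          nlinarith
    _ = (alive n x).card + 1 := by
      rw [sum_add_distrib, sum_const, card_range, nsmul_eq_mul, mul_one_div_cancel hn'.ne',
        sum_boole, filter_mem_eq_inter, inter_eq_right.2 fun j hj => mem_range.2 (mem_alive.1 hj).1]

theorem slack_nonneg (hx : ∀ j < n, |x j| ≤ 1) : 0 ≤ slack n x :=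
  sum_nonneg fun j hj => by
    have := hx j (mem_range.1 hj)
    have : x j ^ 2 ≤ 1 := by rw [← sq_abs]; exact pow_le_one₀ (abs_nonneg _) this
    linarith

/-- The bound on the power mean of the numbers `(A x) i ^ 2 + s` that the algorithm maintains. -/
noncomputable def levelBound (n : ℕ) (s : ℝ) (p : ℕ) (lam : ℝ) (x : ℕ → ℝ) : ℝ :=
  s + 500 * p * lam ^ 2 * (Real.log (1 + n) - Real.log (1 + slack n x))

theorem log_slack_le (hx : ∀ j < n, |x j| ≤ 1) :
    Real.log (1 + slack n x) ≤ Real.log (1 + n) := by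
  have h0 := slack_nonneg hx
  refine Real.log_le_log (by linarith) ?_
  have : slack n x ≤ n := by
    calc slack n x ≤ ∑ j ∈ range n, (1 : ℝ) :=
          sum_le_sum fun j _ => by nlinarith [sq_nonneg (x j)]
      _ = n := by simp
  linarith

theorem le_levelBound (hx : ∀ j < n, |x j| ≤ 1) : s ≤ levelBound n s p lam x := by
  have := log_slack_le hx
  have h : 0 ≤ 500 * p * lam ^ 2 * (Real.log (1 + n) - Real.log (1 + slack n x)) :=
    mul_nonneg (by positivity) (by linarith)
  rw [levelBound]
  linarith

/-- The effect of a good step: it stays in the cube, decreases the slack, and increases the power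
mean at most as fast as the logarithm of the slack decreases. -/
theorem IsGoodStep.progress (h : IsGoodStep A (rowWeight A n s p x) x m n (alive n x) δ d)
    (hcard : 3 ≤ (alive n x).card) (hp : 1 ≤ p) (hs : 0 < s)
    (hA : ∀ i < m, ∀ j < n, |A i j| ≤ √s) (hδn : 2 * n * δ ≤ 1) (hδp : 3 * p * n * δ ≤ 1)
    (hlam : 0 ≤ lam)
    (hdet : ∀ (k : ℕ) (τ : Fin k → ℕ), (∀ a, τ a < n) → ∀ f : Fin k → Fin m,
      |(Matrix.of fun a b => A (f a) (τ b)).det| ≤ lam ^ k)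
    (hx : ∀ j < n, |x j| ≤ 1)
    (hpot : potential A m n s p x ≤ m * levelBound n s p lam x ^ p) :
    (∀ j < n, |x j + d j| ≤ 1) ∧ slack n (fun l => x l + d l) ≤ slack n x - δ ^ 2 ∧
    potential A m n s p (fun l => x l + d l) ≤
      m * levelBound n s p lam (fun l => x l + d l) ^ p := by
  have hp' : (1 : ℝ) ≤ p := by exact_mod_cast hp
  have hn1 : 1 ≤ n := by
    by_contra h0
    have : n = 0 := by omega
    subst this
    simp [alive] at hcard
  have hn' : (1 : ℝ) ≤ n := by exact_mod_cast hn1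
  have hcube : ∀ j < n, |x j + d j| ≤ 1 := by
    intro j hj
    by_cases hja : j ∈ alive n x
    · have h1 := (mem_alive.1 hja).2
      have h2 : |x j| ≤ 1 - 1 / (2 * n) := by
        refine abs_le_of_sq_le_sq ?_ ?_
        · have e : (1 - 1 / (2 * (n : ℝ))) ^ 2 = 1 - 1 / n + (1 / (2 * n)) ^ 2 := by
            field_simp
            ring
          rw [e, sq (x j)]
          nlinarith [sq_nonneg (1 / (2 * (n : ℝ)))]
        · have : 1 / (2 * (n : ℝ)) ≤ 1 := by
            rw [div_le_one (by positivity)]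
            linarith
          linarith
      have h3 : δ ≤ 1 / (2 * n) := by
        rw [le_div_iff₀ (by positivity)]
        linarith
      linarith [abs_add_le (x j) (d j), h.le j hj]
    · rw [h.supp j hj hja, add_zero]
      exact hx j hj
  set D := ∑ l ∈ range n, d l ^ 2 with hD
  have hD0 : 0 ≤ D := sum_nonneg fun _ _ => sq_nonneg _
  set U := slack n x with hU
  set U' := slack n (fun l => x l + d l) with hU'
  have hslack : U' ≤ U - D := by
    have e : U' = U - D - 2 * ∑ l ∈ range n, x l * d l := by
      rw [hU', hU, hD, slack, slack, mul_sum, ← sum_sub_distrib, ← sum_sub_distrib]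
      exact sum_congr rfl fun l _ => by ring
    linarith [h.inner]
  have hU'0 : 0 ≤ U' := slack_nonneg hcube
  refine ⟨hcube, by linarith [h.ge], ?_⟩
  set q := levelBound n s p lam x with hq
  have hqpos : 0 < q := hs.trans_le (le_levelBound hx)
  -- the first and second order terms of the potential
  have hrow : ∀ i < m, 3 * p * |rowDot A n d i| ≤ √s := by
    intro i hi
    have h1 : |rowDot A n d i| ≤ n * (√s * δ) := by
      calc |rowDot A n d i| ≤ ∑ l ∈ range n, |A i l * d l| := abs_sum_le_sum_abs _ _
        _ ≤ ∑ l ∈ range n, √s * δ := by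
          refine sum_le_sum fun l hl => ?_
          rw [abs_mul]
          exact mul_le_mul (hA i hi l (mem_range.1 hl)) (h.le l (mem_range.1 hl))
            (abs_nonneg _) (Real.sqrt_nonneg s)
        _ = n * (√s * δ) := by simp
    calc 3 * p * |rowDot A n d i| ≤ 3 * p * (n * (√s * δ)) := by gcongr
      _ = 3 * p * n * δ * √s := by ring
      _ ≤ 1 * √s := by gcongr
      _ = √s := one_mul _
  have hF := potential_add_le hp hs hrow h.lin
  obtain ⟨τ, μ, hτ, hμ, hμdet, hquad⟩ := h.quad
  have hw : ∀ i < m, 0 ≤ rowWeight A n s p x i := fun i _ => by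
    rw [rowWeight]
    positivity
  obtain ⟨k, hk⟩ : ∃ k, (alive n x).card - 2 = k := ⟨_, rfl⟩
  have hk1 : 1 ≤ k := by omega
  have hkμ := le_of_pow_le_det (by omega) hw hlam (hdet _ τ hτ) hμdet
  rw [hk] at hkμ
  have hW : ∑ i ∈ range m, rowWeight A n s p x i ≤ m * q ^ (p - 1) :=
    sum_pow_sub_one_le hp hqpos (fun i _ => by positivity) hpot
  -- the number of columns that are alive is comparable to the slack
  have hUk : 1 + U ≤ 5 * k := by
    have h1 := slack_le (x := x) hn1
    have h2 : ((alive n x).card : ℝ) = k + 2 := by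
      have : (alive n x).card = k + 2 := by omega
      rw [this]
      push_cast
      ring
    have : (1 : ℝ) ≤ k := by exact_mod_cast hk1
    linarith
  set ℓ := Real.log (1 + U) - Real.log (1 + U') with hℓ
  have hlog : D ≤ (1 + U) * ℓ := by
    have h1 : 0 < 1 + U := by linarith
    have h2 := Real.log_le_sub_one_of_pos (x := (1 + U') / (1 + U)) (by positivity)
    rw [Real.log_div (by positivity) (by positivity)] at h2
    have h3 : (1 + U') / (1 + U) - 1 = (U' - U) / (1 + U) := by
      field_simp
      ring
    rw [h3, le_div_iff₀ h1] at h2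
    rw [hℓ]
    linarith
  have hℓ0 : 0 ≤ ℓ := by
    have : 0 ≤ (1 + U) * ℓ := hD0.trans hlog
    exact nonneg_of_mul_nonneg_right this (by linarith)
  have hmain : 36 * p ^ 2 * (μ * D) ≤ m * (p * q ^ (p - 1) * (500 * p * lam ^ 2 * ℓ)) := by
    have h1 : D ≤ 5 * k * ℓ := hlog.trans (by gcongr)
    have he : Real.exp 1 ≤ 2.72 := by linarith [Real.exp_one_lt_d9]
    have hW0 : 0 ≤ (m : ℝ) * q ^ (p - 1) := by positivity
    calc 36 * (p : ℝ) ^ 2 * (μ * D) ≤ 36 * p ^ 2 * (μ * (5 * k * ℓ)) := by gcongr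
      _ = 180 * p ^ 2 * ℓ * (k * μ) := by ring
      _ ≤ 180 * p ^ 2 * ℓ * (2.72 * lam ^ 2 * (m * q ^ (p - 1))) := by
          refine mul_le_mul_of_nonneg_left (hkμ.trans ?_) (by positivity)
          exact mul_le_mul (mul_le_mul_of_nonneg_right he (sq_nonneg _)) hW
            (sum_nonneg fun i hi => hw i (mem_range.1 hi)) (by positivity)
      _ ≤ 180 * p ^ 2 * ℓ * (500 / 180 * lam ^ 2 * (m * q ^ (p - 1))) := by
          gcongr
          norm_num
      _ = _ := by ring
  have hlevel : levelBound n s p lam (fun l => x l + d l) = q + 500 * p * lam ^ 2 * ℓ := by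
    rw [hq, levelBound, levelBound, hℓ]
    ring
  rw [hlevel]
  set ε := 500 * p * lam ^ 2 * ℓ with hε
  have hε0 : 0 ≤ ε := by positivity
  have hbern : q ^ p + p * q ^ (p - 1) * ε ≤ (q + ε) ^ p := by
    have h1 := one_add_mul_le_pow (a := ε / q) (by have := div_nonneg hε0 hqpos.le; linarith) p
    have h2 : q ^ p * (1 + p * (ε / q)) ≤ q ^ p * (1 + ε / q) ^ p := by gcongr
    have h3 : q ^ p * (1 + ε / q) ^ p = (q + ε) ^ p := by
      rw [← mul_pow]
      congr 1
      field_simp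
    have h4 : q ^ p = q ^ (p - 1) * q := by rw [← pow_succ, Nat.sub_add_cancel hp]
    have h5 : q ^ p * (1 + p * (ε / q)) = q ^ p + p * q ^ (p - 1) * ε := by
      rw [h4]
      field_simp
    linarith
  calc potential A m n s p (fun l => x l + d l)
      ≤ potential A m n s p x +
        9 * p ^ 2 * ∑ i ∈ range m, rowWeight A n s p x i * rowDot A n d i ^ 2 := hF
    _ ≤ m * q ^ p + 9 * p ^ 2 * (4 * μ * D) := by gcongr
    _ = m * q ^ p + 36 * p ^ 2 * (μ * D) := by ring
    _ ≤ m * q ^ p + m * (p * q ^ (p - 1) * ε) := by gcongr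
    _ = m * (q ^ p + p * q ^ (p - 1) * ε) := by ring
    _ ≤ m * (q + ε) ^ p := by gcongr

/-- A small power mean bounds the maximum: with `m ≤ 2 ^ p` the factor `m ^ (1 / p)` is at most
`2`. -/
theorem rowDot_sq_le_of_potential_le {q : ℝ} (hp : 1 ≤ p) (hs : 0 < s) (hq : 0 ≤ q)
    (hmp : m ≤ 2 ^ p) (h : potential A m n s p x ≤ m * q ^ p) {i : ℕ} (hi : i < m) :
    rowDot A n x i ^ 2 ≤ 2 * q := by
  have h1 : (rowDot A n x i ^ 2 + s) ^ p ≤ (2 * q) ^ p := by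
    calc (rowDot A n x i ^ 2 + s) ^ p ≤ potential A m n s p x :=
          single_le_sum (f := fun i => (rowDot A n x i ^ 2 + s) ^ p)
            (fun i _ => by positivity) (mem_range.2 hi)
      _ ≤ m * q ^ p := h
      _ ≤ 2 ^ p * q ^ p := by
        gcongr
        exact_mod_cast hmp
      _ = _ := (mul_pow _ _ _).symm
  have := le_of_pow_le_pow_left₀ (by omega) (by positivity) h1
  linarith

/-- Rounding `x` to signs.  A coordinate that is not alive moves by at most `1 / n`, and the at
most two that are alive move by at most `1`. -/
theorem abs_rowDot_sign_le {x' : ℕ → ℝ} {a : ℝ} {i : ℕ} (hn : 1 ≤ n)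
    (hx : ∀ j < n, |x j| ≤ 1) (hcard : (alive n x).card ≤ 2) (ha : ∀ j < n, |A i j| ≤ a)
    (ha0 : 0 ≤ a) (hx' : ∀ j < n, x' j = if x j < 0 then -1 else 1) :
    |rowDot A n x' i| ≤ |rowDot A n x i| + 3 * a := by
  classical
  have hn' : (0 : ℝ) < n := by exact_mod_cast hn
  have hmove : ∀ j < n, |x' j - x j| ≤ (if j ∈ alive n x then 1 else 0) + 1 / (n : ℝ) := by
    intro j hj
    have habs : |x' j - x j| = 1 - |x j| := by
      have := hx j hj
      rw [hx' j hj]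
      split_ifs with h
      · rw [abs_of_neg h] at this ⊢
        rw [abs_of_nonpos (by linarith)]
        ring
      · rw [abs_of_nonneg (not_lt.1 h)] at this ⊢
        rw [abs_of_nonneg (by linarith)]
    rw [habs]
    by_cases h : j ∈ alive n x
    · rw [if_pos h]
      have : 0 < 1 / (n : ℝ) := by positivity
      linarith [abs_nonneg (x j)]
    · rw [if_neg h]
      have h1 : ¬ x j * x j < 1 - 1 / (n : ℝ) := fun h' => h (mem_alive.2 ⟨hj, h'⟩)
      have h2 : |x j| * |x j| = x j * x j := abs_mul_abs_self _
      nlinarith [hx j hj, abs_nonneg (x j)]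
  have hsum : ∑ j ∈ range n, |x' j - x j| ≤ 3 := by
    calc ∑ j ∈ range n, |x' j - x j|
        ≤ ∑ j ∈ range n, ((if j ∈ alive n x then 1 else 0) + 1 / (n : ℝ)) :=
          sum_le_sum fun j hj => hmove j (mem_range.1 hj)
      _ = (alive n x).card + 1 := by
        rw [sum_add_distrib, sum_const, card_range, nsmul_eq_mul, mul_one_div_cancel hn'.ne',
          sum_boole, filter_mem_eq_inter,
          inter_eq_right.2 fun j hj => mem_range.2 (mem_alive.1 hj).1]
      _ ≤ 3 := by
        have : ((alive n x).card : ℝ) ≤ 2 := by exact_mod_cast hcard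
        linarith
  have e : rowDot A n x' i = rowDot A n x i + rowDot A n (fun l => x' l - x l) i := by
    rw [← rowDot_add]
    exact rowDot_congr (fun l _ => by ring) i
  rw [e]
  refine (abs_add_le _ _).trans (add_le_add_right ?_ _)
  calc |rowDot A n (fun l => x' l - x l) i| ≤ ∑ l ∈ range n, |A i l * (x' l - x l)| :=
        abs_sum_le_sum_abs _ _
    _ ≤ ∑ l ∈ range n, a * |x' l - x l| := by
        refine sum_le_sum fun l hl => ?_
        rw [abs_mul]
        exact mul_le_mul_of_nonneg_right (ha l (mem_range.1 hl)) (abs_nonneg _)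
    _ = a * ∑ l ∈ range n, |x' l - x l| := (mul_sum _ _ _).symm
    _ ≤ a * 3 := by gcongr
    _ = 3 * a := by ring

end Progress

namespace RealRAM

/-! ### Building blocks of the program -/

/-- Entry `(i, j)` of array `a` becomes the sum of the values of `f` over `x < e`. -/
def Prog.accum (a : ℕ) (i j : IExpr) (x : ℕ) (e : IExpr) (f : RExpr) : Prog :=
  .seq (.setArr a i j (.ofIdx (.lit 0)))
    (.forLt x e (.setArr a i j (.add (.get a i j) f)))

theorem IExpr.eval_setArr (e : IExpr) (s : Memory) (a i j : ℕ) (v : ℝ) :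
    e.eval (s.setArr a i j v) = e.eval s := by
  induction e with
  | lit c => rfl
  | reg x => rfl
  | add e f he hf => simp [IExpr.eval, he, hf]
  | sub e f he hf => simp [IExpr.eval, he, hf]

theorem Halts.accum {S : ℕ} {s : Memory} {Q : Memory → Prop} {a x : ℕ} {i j e : IExpr} {f : RExpr}
    (g : ℕ → ℝ)
    (he : e.readsFrom (.forLt x e (.setArr a i j (.add (.get a i j) f))) = false)
    (hi : i.readsFrom (.forLt x e (.setArr a i j (.add (.get a i j) f))) = false)
    (hj : j.readsFrom (.forLt x e (.setArr a i j (.add (.get a i j) f))) = false)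
    (hS : e.eval s ≤ S)
    (hf : ∀ k < e.eval s, ∀ s', Frame (.accum a i j x e f) s s' → s'.idx x = k → f.eval s' = g k)
    (hQ : ∀ s', Frame (.accum a i j x e f) s s' →
      (s'.arr a = fun k l => if k = i.eval s ∧ l = j.eval s then ∑ k ∈ range (e.eval s), g k
        else s.arr a k l) → Q s') :
    Halts S (.accum a i j x e f) s Q := by
  refine Halts.seq (Halts.setArr ?_)
  have hF0 : Frame (.accum a i j x e f) s (s.setArr a (i.eval s) (j.eval s) 0) := by
    refine ⟨fun b hb => ?_, fun _ _ => rfl⟩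
    have : b ≠ a := by
      rintro rfl
      simp [Prog.accum, Prog.writesArr] at hb
    funext k l
    simp [Memory.setArr, this]
  have hF1 : ∀ {s'}, Frame (.forLt x e (.setArr a i j (.add (.get a i j) f)))
      (s.setArr a (i.eval s) (j.eval s) 0) s' → Frame (.accum a i j x e f) s s' := fun h =>
    hF0.trans (h.mono (by simp [Prog.accum, Prog.forLt, Prog.writesArr])
      (by simp [Prog.accum, Prog.forLt, Prog.writesIdx]))
  have ei := i.eval_setArr s a (i.eval s) (j.eval s) 0
  have ej := j.eval_setArr s a (i.eval s) (j.eval s) 0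
  have ee := e.eval_setArr s a (i.eval s) (j.eval s) 0
  simp only [RExpr.eval, IExpr.eval, Nat.cast_zero]
  refine Halts.forLt (fun k s' => s'.arr a = fun r c =>
    if r = i.eval s ∧ c = j.eval s then ∑ k ∈ range k, g k else s.arr a r c) rfl he
    (by rwa [ee]) ?_ ?_ ?_
  · funext r c
    simp [Memory.setIdx, Memory.setArr]
  · intro k hk s' hF hs hI
    rw [ee] at hk
    refine Halts.setArr ?_
    funext r c
    have hi' := (hF.eval_eq hi).trans ei
    have hj' := (hF.eval_eq hj).trans ej
    simp only [Memory.setIdx, Memory.setArr, RExpr.eval, hi', hj',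
      hf k hk s' (hF1 hF) hs, hI, sum_range_succ, true_and, and_self, if_true]
    split_ifs <;> rfl
  · intro s' hF hI
    rw [ee] at hI
    exact hQ s' (hF1 hF) hI

/-- Register `8` becomes an index `j < n` with the largest value of `score` among those that
satisfy `c`; the index `j` is held in register `11`, the largest value so far in array `9`. -/
def argmax (c : Test) (score : RExpr) : Prog :=
  .seq (.setArr 9 (.lit 0) (.lit 0) (.sub (.ofIdx (.lit 0)) (.ofIdx (.lit 1))))
    (.forLt 11 (.reg 1)
      (.branch (.conj c (.rLt (.get 9 (.lit 0) (.lit 0)) score))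
        (.seq (.setArr 9 (.lit 0) (.lit 0) score) (.setIdx 8 (.reg 11)))
        .skip))

theorem halts_argmax {S : ℕ} {s : Memory} {c : Test} {score : RExpr} (P : ℕ → Prop) (σ : ℕ → ℝ)
    (hσ : ∀ j, P j → 0 ≤ σ j) (hS : s.idx 1 ≤ S) (hP : ∃ j < s.idx 1, P j)
    (hc : ∀ j < s.idx 1, ∀ s', Frame (argmax c score) s s' → s'.idx 11 = j →
      (c.Holds s' ↔ P j) ∧ (P j → score.eval s' = σ j)) :
    Halts S (argmax c score) s fun s' => s'.idx 8 < s.idx 1 ∧ P (s'.idx 8) ∧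
      ∀ j < s.idx 1, P j → σ j ≤ σ (s'.idx 8) := by
  refine Halts.seq (Halts.setArr ?_)
  set s₁ := s.setArr 9 (IExpr.eval s (.lit 0)) (IExpr.eval s (.lit 0))
    (RExpr.eval s (.sub (.ofIdx (.lit 0)) (.ofIdx (.lit 1)))) with hs₁
  have hF1 : Frame (argmax c score) s s₁ := by
    refine ⟨fun b hb => ?_, fun _ _ => rfl⟩
    have : b ≠ 9 := by
      rintro rfl
      simp [argmax, Prog.writesArr] at hb
    funext k l
    simp [hs₁, Memory.setArr, this]
  refine Halts.forLt (fun k s' => (∀ j < k, P j → σ j ≤ s'.arr 9 0 0) ∧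
    (s'.arr 9 0 0 = -1 ∨ s'.idx 8 < k ∧ P (s'.idx 8) ∧ s'.arr 9 0 0 = σ (s'.idx 8)))
    rfl rfl hS ?_ ?_ ?_
  · refine ⟨fun j hj => absurd hj (Nat.not_lt_zero j), Or.inl ?_⟩
    simp [hs₁, Memory.setIdx, Memory.setArr, RExpr.eval, IExpr.eval]
  · intro k hk s' hF hs hI
    obtain ⟨hcP, hcσ⟩ := hc k hk s' (hF1.trans (hF.mono
      (by simp +contextual [argmax, Prog.forLt, Prog.writesArr])
      (by simp +contextual [argmax, Prog.forLt, Prog.writesIdx]))) hs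
    refine Halts.branch (fun hb => ?_) (fun hb => ?_)
    · simp only [Test.Holds, hcP, RExpr.eval, IExpr.eval] at hb
      have hcσ := hcσ hb.1
      rw [hcσ] at hb
      refine Halts.seq (Halts.setArr (Halts.setIdx ?_))
      refine ⟨fun j hj hPj => ?_, Or.inr ?_⟩
      · simp only [Memory.setIdx, Memory.setArr, IExpr.eval, and_self, if_true, hcσ]
        rcases Nat.lt_succ_iff_lt_or_eq.1 hj with h | rfl
        · exact (hI.1 j h hPj).trans hb.2.le
        · exact le_rfl
      · simp [Memory.setIdx, Memory.setArr, IExpr.eval, hcσ, hs, hb.1]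
    · simp only [Test.Holds, hcP, RExpr.eval, IExpr.eval, not_and, not_lt] at hb
      refine Halts.skip ⟨fun j hj hPj => ?_, ?_⟩
      · rcases Nat.lt_succ_iff_lt_or_eq.1 hj with h | rfl
        · exact hI.1 j h hPj
        · exact (hcσ hPj).symm.le.trans (hb hPj)
      · rcases hI.2 with h | h
        · exact Or.inl h
        · exact Or.inr ⟨by simpa [Memory.setIdx] using h.1.trans (Nat.lt_succ_self k), h.2⟩
  · rintro s' hF ⟨h1, h2⟩
    obtain ⟨j, hj, hPj⟩ := hP
    have hne : s'.arr 9 0 0 ≠ -1 := fun h => by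
      have := h1 j hj hPj
      have := hσ j hPj
      linarith
    obtain ⟨h3, h4, h5⟩ := h2.resolve_left hne
    exact ⟨h3, h4, fun j hj hPj => h5 ▸ h1 j hj hPj⟩

/-- Array `7` marks the elements of `J` by positive numbers. -/
def Flags (J : Finset ℕ) (s : Memory) : Prop := ∀ j < s.idx 1, 0 < s.arr 7 0 j ↔ j ∈ J

/-- Column `j` is marked in array `7`. -/
def marked : Test := .rLt (.ofIdx (.lit 0)) (.get 7 (.lit 0) (.reg 11))

/-- Mark the coordinates of `x` that are alive, and count them in register `7`. -/
def markAlive : Prog :=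
  .seq (.setIdx 7 (.lit 0))
    (.forLt 11 (.reg 1)
      (.branch
        (.rLt (.mul (.get 1 (.lit 0) (.reg 11)) (.get 1 (.lit 0) (.reg 11)))
          (.sub (.ofIdx (.lit 1)) (.div (.ofIdx (.lit 1)) (.ofIdx (.reg 1)))))
        (.seq (.setArr 7 (.lit 0) (.reg 11) (.ofIdx (.lit 1)))
          (.setIdx 7 (.add (.reg 7) (.lit 1))))
        (.setArr 7 (.lit 0) (.reg 11) (.ofIdx (.lit 0)))))

theorem halts_markAlive {S : ℕ} {s : Memory} (hS : s.idx 1 ≤ S) :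
    Halts S markAlive s fun s' => Flags (alive (s.idx 1) (s.arr 1 0)) s' ∧
      s'.idx 7 = (alive (s.idx 1) (s.arr 1 0)).card := by
  classical
  set P : ℕ → Prop := fun j => s.arr 1 0 j * s.arr 1 0 j < 1 - 1 / (s.idx 1 : ℝ) with hP
  have halive : alive (s.idx 1) (s.arr 1 0) = (range (s.idx 1)).filter P := by
    ext j
    simp [mem_alive, hP]
  refine Halts.seq (Halts.setIdx ?_)
  refine Halts.forLt (fun k s' => (∀ j < k, 0 < s'.arr 7 0 j ↔ P j) ∧
    s'.idx 7 = ((range k).filter P).card) rfl rfl hS ?_ ?_ ?_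
  · simp [Memory.setIdx, IExpr.eval]
  · rintro k hk s' hF hs ⟨h1, h2⟩
    have e1 : s'.arr 1 = s.arr 1 := hF.arr 1 rfl
    have e2 : s'.idx 1 = s.idx 1 := hF.idx 1 rfl
    refine Halts.branch (fun hb => ?_) (fun hb => ?_)
    · have hb : P k := by simpa [Test.Holds, RExpr.eval, IExpr.eval, hs, e1, e2, hP] using hb
      refine Halts.seq (Halts.setArr (Halts.setIdx ⟨fun j hj => ?_, ?_⟩))
      · rcases Nat.lt_succ_iff_lt_or_eq.1 hj with h | rfl
        · simpa [Memory.setIdx, Memory.setArr, IExpr.eval, hs, h.ne] using h1 j h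
        · simp [Memory.setIdx, Memory.setArr, IExpr.eval, RExpr.eval, hs, hb]
      · simp [Memory.setIdx, Memory.setArr, IExpr.eval, h2, range_add_one, filter_insert, hb]
    · have hb : ¬ P k := by simpa [Test.Holds, RExpr.eval, IExpr.eval, hs, e1, e2, hP] using hb
      refine Halts.setArr ⟨fun j hj => ?_, ?_⟩
      · rcases Nat.lt_succ_iff_lt_or_eq.1 hj with h | rfl
        · simpa [Memory.setIdx, Memory.setArr, IExpr.eval, hs, h.ne] using h1 j h
        · simp [Memory.setIdx, Memory.setArr, IExpr.eval, RExpr.eval, hs, hb]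
      · simp [Memory.setIdx, Memory.setArr, h2, range_add_one, filter_insert, hb]
  · rintro s' hF ⟨h1, h2⟩
    have e2 : s'.idx 1 = s.idx 1 := hF.idx 1 rfl
    refine ⟨fun j hj => ?_, by rw [h2, halive]; rfl⟩
    rw [e2] at hj
    rw [h1 j hj, halive, mem_filter, mem_range]
    exact ⟨fun h => ⟨hj, h⟩, fun h => h.2⟩

/-- The products `b = A x` (array `3`) and the weights of the rows (array `4`). -/
def rowWeights : Prog :=
  .forLt 10 (.reg 0)
    (.seq
      (.accum 3 (.lit 0) (.reg 10) 11 (.reg 1)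
        (.mul (.get 0 (.reg 10) (.reg 11)) (.get 1 (.lit 0) (.reg 11))))
      (.seq (.setArr 4 (.lit 0) (.reg 10) (.ofIdx (.lit 1)))
        (.forLt 12 (.sub (.reg 2) (.lit 1))
          (.setArr 4 (.lit 0) (.reg 10) (.mul (.get 4 (.lit 0) (.reg 10))
            (.add (.mul (.get 3 (.lit 0) (.reg 10)) (.get 3 (.lit 0) (.reg 10)))
              (.get 2 (.lit 0) (.lit 0))))))))

theorem halts_rowWeights {S : ℕ} {s : Memory} (h0 : s.idx 0 ≤ S) (h1 : s.idx 1 ≤ S)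
    (h2 : s.idx 2 ≤ S) :
    Halts S rowWeights s fun s' => ∀ i < s.idx 0,
      s'.arr 3 0 i = rowDot (s.arr 0) (s.idx 1) (s.arr 1 0) i ∧
      s'.arr 4 0 i = rowWeight (s.arr 0) (s.idx 1) (s.arr 2 0 0) (s.idx 2) (s.arr 1 0) i := by
  refine Halts.forLt (fun k s' => ∀ i < k,
      s'.arr 3 0 i = rowDot (s.arr 0) (s.idx 1) (s.arr 1 0) i ∧
      s'.arr 4 0 i = rowWeight (s.arr 0) (s.idx 1) (s.arr 2 0 0) (s.idx 2) (s.arr 1 0) i)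
      rfl rfl h0 (fun i hi => absurd hi (Nat.not_lt_zero i)) ?_ fun s' _ h => h
  intro k hk s' hF hs hI
  have a0 : s'.arr 0 = s.arr 0 := hF.arr 0 rfl
  have a1 : s'.arr 1 = s.arr 1 := hF.arr 1 rfl
  have a2 : s'.arr 2 = s.arr 2 := hF.arr 2 rfl
  have i1 : s'.idx 1 = s.idx 1 := hF.idx 1 rfl
  have i2 : s'.idx 2 = s.idx 2 := hF.idx 2 rfl
  refine Halts.seq (Halts.accum (fun j => s.arr 0 k j * s.arr 1 0 j) rfl rfl rfl
    (by simpa [IExpr.eval, i1] using h1) ?_ fun s₁ hF1 h3 => ?_)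
  · intro j _ s₁ hF1 hs1
    have : s₁.idx 10 = s'.idx 10 := hF1.idx 10 rfl
    simp [RExpr.eval, IExpr.eval, hF1.arr 0 rfl, hF1.arr 1 rfl, a0, a1, this, hs, hs1]
  have b2 : s₁.arr 2 = s.arr 2 := (hF1.arr 2 rfl).trans a2
  have b4 : s₁.arr 4 = s'.arr 4 := hF1.arr 4 rfl
  have j10 : s₁.idx 10 = k := (hF1.idx 10 rfl).trans hs
  have j2 : s₁.idx 2 = s.idx 2 := (hF1.idx 2 rfl).trans i2
  simp only [IExpr.eval, hs, i1] at h3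
  have h3k : s₁.arr 3 0 k = rowDot (s.arr 0) (s.idx 1) (s.arr 1 0) k := by
    rw [h3]
    simp [rowDot]
  have h3i : ∀ i, i ≠ k → s₁.arr 3 0 i = s'.arr 3 0 i := fun i hi => by
    rw [h3]
    simp [hi]
  refine Halts.seq (Halts.setArr ?_)
  refine Halts.forLt (fun r s₂ => s₂.arr 4 = fun l i => if l = 0 ∧ i = k then
    (rowDot (s.arr 0) (s.idx 1) (s.arr 1 0) k ^ 2 + s.arr 2 0 0) ^ r else s'.arr 4 l i)
    rfl rfl ?_ ?_ ?_ ?_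
  · simp only [IExpr.eval, Memory.setArr, j2]
    omega
  · funext l i
    simp [Memory.setIdx, Memory.setArr, IExpr.eval, RExpr.eval, j10, b4]
  · intro r _ s₂ hF2 _ hI2
    have j10' : s₂.idx 10 = k := (hF2.idx 10 rfl).trans j10
    have b2' : s₂.arr 2 = s.arr 2 := (hF2.arr 2 rfl).trans (by
      funext i j; simp [Memory.setArr, b2])
    have b3' : s₂.arr 3 = s₁.arr 3 := (hF2.arr 3 rfl).trans (by
      funext i j; simp [Memory.setArr])
    refine Halts.setArr ?_
    funext l i
    simp only [Memory.setIdx, Memory.setArr, IExpr.eval, RExpr.eval, j10', b2', b3', h3k, hI2,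
      and_self, if_true, true_and, pow_succ _ r]
    split_ifs
    · ring
    · rfl
  · intro s₂ hF2 hI2
    have b3' : s₂.arr 3 = s₁.arr 3 := (hF2.arr 3 rfl).trans (by
      funext i j; simp [Memory.setArr])
    simp only [IExpr.eval, Memory.setArr, j2] at hI2
    intro i hi
    simp only [Memory.setIdx]
    rw [b3', hI2]
    rcases Nat.lt_succ_iff_lt_or_eq.1 hi with h | rfl
    · simpa [h3i i h.ne, h.ne] using hI i h
    · simp [h3k, rowWeight]

/-- The unit vectors (array `5`, the columns of `Y`), the weighted Gram matrix (array `6`), and, as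
row `n` of array `6`, the gradient. -/
def initForm : Prog :=
  .forLt 11 (.reg 1)
    (.seq
      (.forLt 12 (.reg 1)
        (.seq (.setArr 5 (.reg 12) (.reg 11) (.ofIdx (.lit 0)))
          (.accum 6 (.reg 12) (.reg 11) 10 (.reg 0)
            (.mul (.mul (.get 4 (.lit 0) (.reg 10)) (.get 0 (.reg 10) (.reg 12)))
              (.get 0 (.reg 10) (.reg 11))))))
      (.seq (.setArr 5 (.reg 11) (.reg 11) (.ofIdx (.lit 1)))
        (.accum 6 (.reg 1) (.reg 11) 10 (.reg 0)
          (.mul (.mul (.get 4 (.lit 0) (.reg 10)) (.get 3 (.lit 0) (.reg 10)))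
            (.get 0 (.reg 10) (.reg 11))))))

theorem halts_initForm {S : ℕ} {s : Memory} (h0 : s.idx 0 ≤ S) (h1 : s.idx 1 ≤ S) :
    Halts S initForm s fun s' => ∀ j < s.idx 1,
      (∀ l < s.idx 1, s'.arr 5 l j = (if l = j then 1 else 0) ∧
        s'.arr 6 l j = gram (s.arr 0) (s.arr 4 0) (s.idx 0) l j) ∧
      s'.arr 6 (s.idx 1) j =
        ∑ i ∈ range (s.idx 0), s.arr 4 0 i * s.arr 3 0 i * s.arr 0 i j := by
  refine Halts.forLt (fun k s' => ∀ j < k,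
      (∀ l < s.idx 1, s'.arr 5 l j = (if l = j then 1 else 0) ∧
        s'.arr 6 l j = gram (s.arr 0) (s.arr 4 0) (s.idx 0) l j) ∧
      s'.arr 6 (s.idx 1) j =
        ∑ i ∈ range (s.idx 0), s.arr 4 0 i * s.arr 3 0 i * s.arr 0 i j)
      rfl rfl h1 (fun i hi => absurd hi (Nat.not_lt_zero i)) ?_ fun s' _ h => h
  intro k hk s' hF hs hI
  have a0 : s'.arr 0 = s.arr 0 := hF.arr 0 rfl
  have a3 : s'.arr 3 = s.arr 3 := hF.arr 3 rfl
  have a4 : s'.arr 4 = s.arr 4 := hF.arr 4 rfl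
  have i0 : s'.idx 0 = s.idx 0 := hF.idx 0 rfl
  have i1 : s'.idx 1 = s.idx 1 := hF.idx 1 rfl
  refine Halts.seq (Halts.forLt (fun r s₁ =>
    (∀ l < r, s₁.arr 5 l k = 0 ∧ s₁.arr 6 l k = gram (s.arr 0) (s.arr 4 0) (s.idx 0) l k) ∧
    ∀ l, ∀ j < k, s₁.arr 5 l j = s'.arr 5 l j ∧ s₁.arr 6 l j = s'.arr 6 l j)
    rfl rfl (by simpa [IExpr.eval, i1] using h1) ?_ ?_ ?_)
  · exact ⟨fun l hl => absurd hl (Nat.not_lt_zero l), fun l j _ => ⟨rfl, rfl⟩⟩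
  · rintro r - s₁ hF1 hs1 ⟨hI1, hI2⟩
    have j11 : s₁.idx 11 = k := (hF1.idx 11 rfl).trans hs
    have j0 : s₁.idx 0 = s.idx 0 := (hF1.idx 0 rfl).trans i0
    have b0 : s₁.arr 0 = s.arr 0 := (hF1.arr 0 rfl).trans a0
    have b4 : s₁.arr 4 = s.arr 4 := (hF1.arr 4 rfl).trans a4
    refine Halts.seq (Halts.setArr (Halts.accum
      (fun i => s.arr 4 0 i * s.arr 0 i r * s.arr 0 i k) rfl rfl rfl
      (by simpa [IExpr.eval, Memory.setArr, j0] using h0) ?_ fun s₂ hF2 h6 => ?_))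
    · intro i _ s₂ hF2 hs2
      have k11 : s₂.idx 11 = k := (hF2.idx 11 rfl).trans j11
      have k12 : s₂.idx 12 = r := (hF2.idx 12 rfl).trans hs1
      have c0 : s₂.arr 0 = s.arr 0 := (hF2.arr 0 rfl).trans (by
        funext i j; simp [Memory.setArr, b0])
      have c4 : s₂.arr 4 = s.arr 4 := (hF2.arr 4 rfl).trans (by
        funext i j; simp [Memory.setArr, b4])
      simp [RExpr.eval, IExpr.eval, k11, k12, c0, c4, hs2]
    · have h5 : s₂.arr 5 = fun l j => if l = r ∧ j = k then 0 else s₁.arr 5 l j :=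
        (hF2.arr 5 rfl).trans (by
          funext i j; simp [Memory.setArr, RExpr.eval, IExpr.eval, hs1, j11])
      have h6 : s₂.arr 6 = fun l j => if l = r ∧ j = k then
          gram (s.arr 0) (s.arr 4 0) (s.idx 0) r k else s₁.arr 6 l j := by
        rw [h6]
        funext i j
        simp [Memory.setArr, IExpr.eval, hs1, j11, j0, gram]
      refine ⟨fun l hl => ?_, fun l j hj => ?_⟩
      · simp only [Memory.setIdx, h5, h6]
        rcases Nat.lt_succ_iff_lt_or_eq.1 hl with h | rfl
        · simpa [h.ne] using hI1 l h
        · simp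
      · simpa [Memory.setIdx, h5, h6, hj.ne] using hI2 l j hj
  · rintro s₁ hF1 ⟨hI1, hI2⟩
    simp only [IExpr.eval, i1] at hI1
    have j11 : s₁.idx 11 = k := (hF1.idx 11 rfl).trans hs
    have j0 : s₁.idx 0 = s.idx 0 := (hF1.idx 0 rfl).trans i0
    have j1 : s₁.idx 1 = s.idx 1 := (hF1.idx 1 rfl).trans i1
    have b0 : s₁.arr 0 = s.arr 0 := (hF1.arr 0 rfl).trans a0
    have b3 : s₁.arr 3 = s.arr 3 := (hF1.arr 3 rfl).trans a3
    have b4 : s₁.arr 4 = s.arr 4 := (hF1.arr 4 rfl).trans a4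
    refine Halts.seq (Halts.setArr (Halts.accum
      (fun i => s.arr 4 0 i * s.arr 3 0 i * s.arr 0 i k) rfl rfl rfl
      (by simpa [IExpr.eval, Memory.setArr, j0] using h0) ?_ fun s₂ hF2 h6 => ?_))
    · intro i _ s₂ hF2 hs2
      have k11 : s₂.idx 11 = k := (hF2.idx 11 rfl).trans j11
      have c0 : s₂.arr 0 = s.arr 0 := (hF2.arr 0 rfl).trans (by
        funext i j; simp [Memory.setArr, b0])
      have c3 : s₂.arr 3 = s.arr 3 := (hF2.arr 3 rfl).trans (by
        funext i j; simp [Memory.setArr, b3])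
      have c4 : s₂.arr 4 = s.arr 4 := (hF2.arr 4 rfl).trans (by
        funext i j; simp [Memory.setArr, b4])
      simp [RExpr.eval, IExpr.eval, k11, c0, c3, c4, hs2]
    · have h5 : s₂.arr 5 = fun l j => if l = k ∧ j = k then 1 else s₁.arr 5 l j :=
        (hF2.arr 5 rfl).trans (by
          funext i j; simp [Memory.setArr, RExpr.eval, IExpr.eval, j11])
      have h6 : s₂.arr 6 = fun l j => if l = s.idx 1 ∧ j = k then
          ∑ i ∈ range (s.idx 0), s.arr 4 0 i * s.arr 3 0 i * s.arr 0 i k else s₁.arr 6 l j := by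
        rw [h6]
        funext i j
        simp [Memory.setArr, IExpr.eval, j11, j0, j1]
      intro j hj
      simp only [Memory.setIdx, h5, h6]
      rcases Nat.lt_succ_iff_lt_or_eq.1 hj with h | rfl
      · simpa [h.ne, hI2 _ j h] using hI j h
      · refine ⟨fun l hl => ?_, by simp⟩
        by_cases hlj : l = j
        · subst hlj
          simp [hl.ne, hI1 l hl]
        · simp [hl.ne, hlj, hI1 l hl]

/-- A pivot step: with `t` in register `8`, column `t` is unmarked, and the multiple of column `t`
that clears its entry in row `r` of array `6` is subtracted from every marked column, in both
arrays `5` and `6`. -/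
def pivot (r : IExpr) : Prog :=
  .seq (.setArr 7 (.lit 0) (.reg 8) (.ofIdx (.lit 0)))
    (.forLt 11 (.reg 1)
      (.branch marked
        (.seq (.setArr 8 (.lit 0) (.lit 0) (.div (.get 6 r (.reg 11)) (.get 6 r (.reg 8))))
          (.forLt 12 (.add (.reg 1) (.lit 1))
            (.seq
              (.setArr 5 (.reg 12) (.reg 11) (.sub (.get 5 (.reg 12) (.reg 11))
                (.mul (.get 8 (.lit 0) (.lit 0)) (.get 5 (.reg 12) (.reg 8)))))
              (.setArr 6 (.reg 12) (.reg 11) (.sub (.get 6 (.reg 12) (.reg 11))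
                (.mul (.get 8 (.lit 0) (.lit 0)) (.get 6 (.reg 12) (.reg 8))))))))
        .skip))

theorem halts_pivot {S : ℕ} {s : Memory} {r : IExpr} {J : Finset ℕ}
    (hr : r.readsFrom (pivot r) = false) (hS : s.idx 1 + 1 ≤ S) (hJ : Flags J s) :
    Halts S (pivot r) s fun s' => Flags (J.erase (s.idx 8)) s' ∧
      ∀ j ∈ J, j ≠ s.idx 8 → j < s.idx 1 → ∀ l < s.idx 1 + 1,
        s'.arr 5 l j = s.arr 5 l j -
          s.arr 6 (r.eval s) j / s.arr 6 (r.eval s) (s.idx 8) * s.arr 5 l (s.idx 8) ∧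
        s'.arr 6 l j = s.arr 6 l j -
          s.arr 6 (r.eval s) j / s.arr 6 (r.eval s) (s.idx 8) * s.arr 6 l (s.idx 8) := by
  set t := s.idx 8 with ht
  set ρ := r.eval s with hρ
  refine Halts.seq (Halts.setArr ?_)
  simp only [IExpr.eval, RExpr.eval, Nat.cast_zero, ← ht]
  set s₁ := s.setArr 7 0 t 0 with hs₁
  have hF1 : Frame (pivot r) s s₁ := by
    refine ⟨fun b hb => ?_, fun _ _ => rfl⟩
    have : b ≠ 7 := by
      rintro rfl
      simp [pivot, Prog.writesArr] at hb
    funext k l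
    simp [hs₁, Memory.setArr, this]
  have hflag : ∀ j < s.idx 1, 0 < s₁.arr 7 0 j ↔ j ∈ J.erase t := by
    intro j hj
    rw [mem_erase]
    by_cases h : j = t
    · simp [hs₁, Memory.setArr, h]
    · simpa [hs₁, Memory.setArr, h] using hJ j hj
  refine Halts.forLt (fun k s' => (∀ j ∈ J, j ≠ t → j < k → ∀ l < s.idx 1 + 1,
        s'.arr 5 l j = s.arr 5 l j - s.arr 6 ρ j / s.arr 6 ρ t * s.arr 5 l t ∧
        s'.arr 6 l j = s.arr 6 l j - s.arr 6 ρ j / s.arr 6 ρ t * s.arr 6 l t) ∧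
      ∀ l j, j = t ∨ k ≤ j → s'.arr 5 l j = s.arr 5 l j ∧ s'.arr 6 l j = s.arr 6 l j)
      rfl rfl (by simp only [IExpr.eval, hs₁, Memory.setArr]; omega) ?_ ?_ ?_
  · refine ⟨fun j _ _ hj => absurd hj (Nat.not_lt_zero j), fun l j _ => ?_⟩
    simp [hs₁, Memory.setIdx, Memory.setArr]
  · rintro k hk s' hF hs ⟨hI1, hI2⟩
    have hk : k < s.idx 1 := hk
    have hFp : Frame (pivot r) s s' := hF1.trans (hF.mono
      (by simp +contextual [pivot, Prog.forLt, Prog.writesArr])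
      (by simp +contextual [pivot, Prog.forLt, Prog.writesIdx]))
    have hr' : r.eval s' = ρ := hFp.eval_eq hr
    have i8 : s'.idx 8 = t := hFp.idx 8 rfl
    have i1 : s'.idx 1 = s.idx 1 := hFp.idx 1 rfl
    have a7 : s'.arr 7 = s₁.arr 7 := hF.arr 7 rfl
    have hm : marked.Holds s' ↔ k ∈ J.erase t := by
      rw [← hflag k hk]
      simp [marked, Test.Holds, RExpr.eval, IExpr.eval, hs, a7]
    refine Halts.branch (fun hb => ?_) (fun hb => ?_)
    · rw [hm, mem_erase] at hb
      obtain ⟨hkt, hkJ⟩ := hb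
      have hc : RExpr.eval s' (.div (.get 6 r (.reg 11)) (.get 6 r (.reg 8))) =
          s.arr 6 ρ k / s.arr 6 ρ t := by
        simp [RExpr.eval, IExpr.eval, hr', hs, i8, hI2 ρ k (Or.inr le_rfl),
          hI2 ρ t (Or.inl rfl)]
      refine Halts.seq (Halts.setArr ?_)
      rw [hc]
      set c := s.arr 6 ρ k / s.arr 6 ρ t with hcdef
      simp only [IExpr.eval]
      refine Halts.forLt (fun q s₂ =>
        (s₂.arr 5 = fun l j => if j = k ∧ l < q then s.arr 5 l k - c * s.arr 5 l t
          else s'.arr 5 l j) ∧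
        (s₂.arr 6 = fun l j => if j = k ∧ l < q then s.arr 6 l k - c * s.arr 6 l t
          else s'.arr 6 l j)) rfl rfl ?_ ?_ ?_ ?_
      · simp only [IExpr.eval, Memory.setArr, i1]
        exact hS
      · constructor <;> funext l j <;> simp [Memory.setIdx, Memory.setArr]
      · rintro q - s₂ hF2 hs2 ⟨h5, h6⟩
        have j11 : s₂.idx 11 = k := (hF2.idx 11 rfl).trans hs
        have j8 : s₂.idx 8 = t := (hF2.idx 8 rfl).trans i8
        have b8 : s₂.arr 8 0 0 = c := by
          rw [hF2.arr 8 rfl]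
          simp [Memory.setArr]
        have hk5 : s'.arr 5 q k = s.arr 5 q k ∧ s'.arr 6 q k = s.arr 6 q k :=
          hI2 q k (Or.inr le_rfl)
        have ht5 : s'.arr 5 q t = s.arr 5 q t ∧ s'.arr 6 q t = s.arr 6 q t :=
          hI2 q t (Or.inl rfl)
        have htk : t ≠ k := fun e => hkt e.symm
        refine Halts.seq (Halts.setArr (Halts.setArr ⟨?_, ?_⟩))
        · funext l j
          simp only [Memory.setIdx, Memory.setArr, RExpr.eval, IExpr.eval, j11, j8, b8, hs2, h5]
          by_cases hj : j = k
          · subst hj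
            rcases lt_trichotomy l q with h | rfl | h
            · simp [h, h.ne, h.trans (Nat.lt_succ_self q)]
            · simp [htk, hk5, ht5]
            · simp [h.ne', not_lt.2 h.le, show ¬ l < q + 1 by omega]
          · simp [hj]
        · funext l j
          simp only [Memory.setIdx, Memory.setArr, RExpr.eval, IExpr.eval, j11, j8, b8, hs2, h6]
          by_cases hj : j = k
          · subst hj
            rcases lt_trichotomy l q with h | rfl | h
            · simp [h, h.ne, h.trans (Nat.lt_succ_self q)]
            · simp [htk, hk5, ht5]
            · simp [h.ne', not_lt.2 h.le, show ¬ l < q + 1 by omega]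
          · simp [hj]
      · rintro s₂ hF2 ⟨h5, h6⟩
        simp only [IExpr.eval, Memory.setArr, i1] at h5 h6
        refine ⟨fun j hj hjt hjk l hl => ?_, fun l j hj => ?_⟩
        · simp only [Memory.setIdx, h5, h6]
          rcases Nat.lt_succ_iff_lt_or_eq.1 hjk with h | rfl
          · simpa [h.ne] using hI1 j hj hjt h l hl
          · simp [hl, hcdef]
        · have hne : j ≠ k := by
            rcases hj with rfl | hj
            · exact fun e => hkt e.symm
            · omega
          simpa [Memory.setIdx, h5, h6, hne] using
            hI2 l j (hj.imp_right fun h => (Nat.le_succ k).trans h)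
    · rw [hm, mem_erase] at hb
      refine Halts.skip ⟨fun j hj hjt hjk l hl => ?_, fun l j hj => ?_⟩
      · rcases Nat.lt_succ_iff_lt_or_eq.1 hjk with h | rfl
        · exact hI1 j hj hjt h l hl
        · exact absurd ⟨hjt, hj⟩ hb
      · exact hI2 l j (hj.imp_right fun h => (Nat.le_succ k).trans h)
  · rintro s' hF ⟨hI1, -⟩
    refine ⟨fun j hj => ?_, fun j hj hjt hjn => hI1 j hj hjt hjn⟩
    have e : s'.idx 1 = s.idx 1 := hF.idx 1 rfl
    rw [e] at hj
    rw [hF.arr 7 rfl]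
    exact hflag j hj

end RealRAM

theorem gram_congr {w w' : ℕ → ℝ} {m : ℕ} (h : ∀ i < m, w i = w' i) (A : ℕ → ℕ → ℝ) :
    gram A w m = gram A w' m := by
  funext j l
  exact sum_congr rfl fun i hi => by rw [h i (mem_range.1 hi)]

namespace RealRAM

/-! ### One round of the walk -/

/-- Array `5` holds the state of an elimination with the columns in `J` marked; array `6` holds
the products of the columns with the Gram matrix and, in row `n`, the values of the linear
functional `u` at the columns. -/
structure Reduced (A : ℕ → ℕ → ℝ) (w : ℕ → ℝ) (m n : ℕ) (u : ℕ → ℝ) (N J : Finset ℕ) {r : ℕ}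
    (τ : Fin r → ℕ) (s : Memory) : Prop where
  inj : τ.Injective
  elim : Elim A w m n N J τ (s.arr 5)
  flags : Flags J s
  form : ∀ j ∈ J, ∀ l < n,
    s.arr 6 l j = rowDot (gram A w m) n (fun l => s.arr 5 l j) l
  lin : ∀ j ∈ J, s.arr 6 n j = ∑ l ∈ range n, u l * s.arr 5 l j

/-- Elimination on the Gram matrix until two columns are left. -/
def eliminate : Prog :=
  .forLt 14 (.sub (.reg 7) (.lit 2))
    (.seq (argmax marked (.get 6 (.reg 11) (.reg 11))) (pivot (.reg 8)))

theorem halts_eliminate {S : ℕ} {s : Memory} {A : ℕ → ℕ → ℝ} {w u : ℕ → ℝ} {m : ℕ} {N : Finset ℕ}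
    (hw : ∀ i < m, 0 ≤ w i) (h7 : s.idx 7 = N.card) (hS : s.idx 1 + 1 ≤ S)
    (h : Reduced A w m (s.idx 1) u N N (Fin.elim0 : Fin 0 → ℕ) s) :
    Halts S eliminate s fun s' => ∃ (J : Finset ℕ) (τ : Fin (N.card - 2) → ℕ),
      Reduced A w m (s.idx 1) u N J τ s' := by
  have hN : N.card ≤ s.idx 1 := by
    simpa using card_le_card fun j hj => mem_range.2 (h.elim.lt j hj)
  refine Halts.forLt (fun r s' => ∃ (J : Finset ℕ) (τ : Fin r → ℕ),
      Reduced A w m (s.idx 1) u N J τ s') rfl rfl (by simp only [IExpr.eval]; omega) ?_ ?_ ?_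
  · exact ⟨N, Fin.elim0, h.inj, h.elim, h.flags, h.form, h.lin⟩
  · rintro r hr s' hF hs ⟨J, τ, hI⟩
    simp only [IExpr.eval, h7] at hr
    have i1 : s'.idx 1 = s.idx 1 := hF.idx 1 rfl
    have hJ : J.Nonempty := by
      rw [← card_pos]
      have := hI.elim.card
      omega
    obtain ⟨j₀, hj₀⟩ := hJ
    refine Halts.seq (Halts.imp (halts_argmax (· ∈ J)
      (fun j => rowDot (gram A w m) (s.idx 1) (fun l => s'.arr 5 l j) j)
      (fun j hj => hI.elim.form_nonneg hw hj) (by omega)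
      ⟨j₀, by rw [i1]; exact hI.elim.lt _ (hI.elim.sub hj₀), hj₀⟩ ?_) ?_)
    · intro j hj s₁ hF1 hs1
      have b6 : s₁.arr 6 = s'.arr 6 := hF1.arr 6 rfl
      have b7 : s₁.arr 7 = s'.arr 7 := hF1.arr 7 rfl
      refine ⟨?_, fun hjJ => ?_⟩
      · rw [← hI.flags j hj]
        simp [marked, Test.Holds, RExpr.eval, IExpr.eval, hs1, b7]
      · simp only [RExpr.eval, IExpr.eval, hs1, b6]
        exact hI.form j hjJ j (by omega)
    · rintro s₁ hF1 ⟨ht, htJ, hmax⟩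
      have b5 : s₁.arr 5 = s'.arr 5 := hF1.arr 5 rfl
      have b6 : s₁.arr 6 = s'.arr 6 := hF1.arr 6 rfl
      have b7 : s₁.arr 7 = s'.arr 7 := hF1.arr 7 rfl
      have j1 : s₁.idx 1 = s.idx 1 := (hF1.idx 1 rfl).trans i1
      refine Halts.imp (halts_pivot (r := .reg 8) (J := J) rfl (by omega) ?_) ?_
      · intro j hj
        rw [b7]
        exact hI.flags j (by omega)
      rintro s₂ hF2 ⟨hfl, hcol⟩
      have k1 : s₂.idx 1 = s.idx 1 := (hF2.idx 1 rfl).trans j1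
      set t := s₁.idx 8 with htdef
      rw [i1] at ht hmax
      simp only [IExpr.eval, ← htdef, b5, b6, j1] at hcol
      -- the coefficients in terms of the form
      have hcol' : ∀ j ∈ J, j ≠ t → ∀ l < s.idx 1 + 1,
          s₂.arr 5 l j = s'.arr 5 l j -
            rowDot (gram A w m) (s.idx 1) (fun l => s'.arr 5 l j) t /
              rowDot (gram A w m) (s.idx 1) (fun l => s'.arr 5 l t) t * s'.arr 5 l t ∧
          s₂.arr 6 l j = s'.arr 6 l j -
            rowDot (gram A w m) (s.idx 1) (fun l => s'.arr 5 l j) t /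
              rowDot (gram A w m) (s.idx 1) (fun l => s'.arr 5 l t) t * s'.arr 6 l t := by
        intro j hj hjt l hl
        have := hcol j hj hjt (hI.elim.lt j (hI.elim.sub hj)) l hl
        rwa [hI.form j hj t ht, hI.form t htJ t ht] at this
      obtain ⟨hinj, hel⟩ := hI.elim.step hI.inj hw htJ
        (fun j hj => hmax j (hI.elim.lt j (hI.elim.sub hj)) hj)
        (fun j hj hjt l hl => (hcol' j hj hjt l (hl.trans (Nat.lt_succ_self _))).1)
      refine ⟨J.erase t, Fin.cons t τ, hinj, hel, fun j hj => hfl j hj, fun j hj l hl => ?_,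
        fun j hj => ?_⟩
      · obtain ⟨hjt, hjJ⟩ := mem_erase.1 hj
        simp only [Memory.setIdx]
        rw [(hcol' j hjJ hjt l (by omega)).2, hI.form j hjJ l hl, hI.form t htJ l hl,
          ← rowDot_sub_mul]
        exact (rowDot_congr (fun l hl => (hcol' j hjJ hjt l (by omega)).1) l).symm
      · obtain ⟨hjt, hjJ⟩ := mem_erase.1 hj
        simp only [Memory.setIdx]
        rw [(hcol' j hjJ hjt _ (by omega)).2, hI.lin j hjJ, hI.lin t htJ, mul_sum,
          ← sum_sub_distrib]
        refine sum_congr rfl fun l hl => ?_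
        rw [(hcol' j hjJ hjt l (by have := mem_range.1 hl; omega)).1]
        ring
  · rintro s' hF hI
    have e : IExpr.eval s (.sub (.reg 7) (.lit 2)) = N.card - 2 := by simp [IExpr.eval, h7]
    rwa [e] at hI

/-- The last two columns are combined into a column on which the linear functional vanishes.  Its
number goes to register `9`, the number of its largest entry to register `8`. -/
def direction : Prog :=
  .seq (argmax marked (.mul (.get 6 (.reg 1) (.reg 11)) (.get 6 (.reg 1) (.reg 11))))
    (.seq (pivot (.reg 1))
      (.seq (argmax marked (.ofIdx (.lit 0)))
        (.seq (.setIdx 9 (.reg 8))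
          (argmax (.iLt (.reg 11) (.reg 1))
            (.mul (.get 5 (.reg 11) (.reg 9)) (.get 5 (.reg 11) (.reg 9)))))))

theorem halts_direction {S : ℕ} {s : Memory} {A : ℕ → ℕ → ℝ} {w u : ℕ → ℝ} {m : ℕ}
    {N J : Finset ℕ} {τ : Fin (N.card - 2) → ℕ} (hw : ∀ i < m, 0 ≤ w i) (hS : s.idx 1 + 1 ≤ S)
    (hN : 3 ≤ N.card) (h : Reduced A w m (s.idx 1) u N J τ s) :
    Halts S direction s fun s' => s'.idx 9 < s.idx 1 ∧ s'.arr 5 (s'.idx 9) (s'.idx 9) = 1 ∧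
      (∀ l < s.idx 1, l ∉ N → s'.arr 5 l (s'.idx 9) = 0) ∧
      ∑ l ∈ range (s.idx 1), u l * s'.arr 5 l (s'.idx 9) = 0 ∧
      s'.idx 8 < s.idx 1 ∧
      (∀ l < s.idx 1, s'.arr 5 l (s'.idx 9) * s'.arr 5 l (s'.idx 9) ≤
        s'.arr 5 (s'.idx 8) (s'.idx 9) * s'.arr 5 (s'.idx 8) (s'.idx 9)) ∧
      ∃ μ : ℝ, 0 ≤ μ ∧
        μ ^ (N.card - 2) ≤ (Matrix.of fun a b => gram A w m (τ a) (τ b)).det ∧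
        ∑ i ∈ range m, w i * rowDot A (s.idx 1) (fun l => s'.arr 5 l (s'.idx 9)) i ^ 2 ≤
          4 * μ := by
  have hJ2 : J.card = 2 := by
    have := h.elim.card
    omega
  have hJn : ∀ j ∈ J, j < s.idx 1 := fun j hj => h.elim.lt j (h.elim.sub hj)
  obtain ⟨j₀, hj₀⟩ : J.Nonempty := by
    rw [← card_pos]
    omega
  refine Halts.seq (Halts.imp (halts_argmax (· ∈ J)
    (fun j => s.arr 6 (s.idx 1) j * s.arr 6 (s.idx 1) j) (fun j _ => mul_self_nonneg _) (by omega)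
    ⟨j₀, hJn j₀ hj₀, hj₀⟩ ?_) ?_)
  · intro j hj s₁ hF1 hs1
    refine ⟨?_, fun _ => ?_⟩
    · rw [← h.flags j hj]
      simp [marked, Test.Holds, RExpr.eval, IExpr.eval, hs1, hF1.arr 7 rfl]
    · simp [RExpr.eval, IExpr.eval, hs1, hF1.arr 6 rfl, hF1.idx 1 rfl]
  rintro s₁ hF1 ⟨ht, htJ, hmax⟩
  have b5 : s₁.arr 5 = s.arr 5 := hF1.arr 5 rfl
  have b6 : s₁.arr 6 = s.arr 6 := hF1.arr 6 rfl
  have b7 : s₁.arr 7 = s.arr 7 := hF1.arr 7 rfl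
  have j1 : s₁.idx 1 = s.idx 1 := hF1.idx 1 rfl
  refine Halts.seq (Halts.imp (halts_pivot (r := .reg 1) (J := J) rfl (by omega) ?_) ?_)
  · intro j hj
    rw [b7]
    exact h.flags j (by omega)
  rintro s₂ hF2 ⟨hfl, hcol⟩
  have k1 : s₂.idx 1 = s.idx 1 := (hF2.idx 1 rfl).trans j1
  set t := s₁.idx 8 with htdef
  simp only [IExpr.eval, b5, b6, j1] at hcol
  obtain ⟨j₁, hj₁⟩ : (J.erase t).Nonempty := by
    rw [← card_pos, card_erase_of_mem htJ]
    omega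
  refine Halts.seq (Halts.imp (halts_argmax (· ∈ J.erase t) (fun _ => 0) (fun j _ => le_rfl)
    (by omega) ⟨j₁, by rw [k1]; exact hJn _ (mem_of_mem_erase hj₁), hj₁⟩ ?_) ?_)
  · intro j hj s₃ hF3 hs3
    refine ⟨?_, fun _ => by simp [RExpr.eval, IExpr.eval]⟩
    rw [← hfl j hj]
    simp [marked, Test.Holds, RExpr.eval, IExpr.eval, hs3, hF3.arr 7 rfl]
  rintro s₃ hF3 ⟨-, hqJ, -⟩
  have c5 : s₃.arr 5 = s₂.arr 5 := hF3.arr 5 rfl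
  have l1 : s₃.idx 1 = s.idx 1 := (hF3.idx 1 rfl).trans k1
  refine Halts.seq (Halts.setIdx ?_)
  simp only [IExpr.eval]
  set q := s₃.idx 8 with hq
  obtain ⟨hqt, hqJ⟩ := mem_erase.1 hqJ
  have hqn := hJn q hqJ
  refine Halts.imp (halts_argmax (· < s.idx 1) (fun j => s₂.arr 5 j q * s₂.arr 5 j q)
    (fun j _ => mul_self_nonneg _) (by simp [Memory.setIdx, l1]; omega)
    ⟨q, by simpa [Memory.setIdx, l1] using hqn, hqn⟩ ?_) ?_
  · intro j _ s₄ hF4 hs4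
    have m1 : s₄.idx 1 = s.idx 1 := (hF4.idx 1 rfl).trans l1
    have m9 : s₄.idx 9 = q := (hF4.idx 9 rfl).trans (by simp [Memory.setIdx])
    have d5 : s₄.arr 5 = s₂.arr 5 := (hF4.arr 5 rfl).trans c5
    exact ⟨by simp [Test.Holds, IExpr.eval, hs4, m1],
      fun _ => by simp [RExpr.eval, IExpr.eval, hs4, m9, d5]⟩
  rintro s₄ hF4 ⟨hz, -, hmax4⟩
  have l1' : (s₃.setIdx 9 q).idx 1 = s.idx 1 := l1
  rw [l1'] at hz hmax4
  have m9 : s₄.idx 9 = q := (hF4.idx 9 rfl).trans (by simp [Memory.setIdx])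
  have d5 : s₄.arr 5 = s₂.arr 5 := (hF4.arr 5 rfl).trans c5
  rw [m9, d5]
  have hker := h.elim.exists_kernel_bound (u := u) hw hqJ htJ hqt
    (by
      rw [← h.lin q hqJ, ← h.lin t htJ, sq, sq]
      exact hmax q hqn hqJ)
    (y := fun l => s₂.arr 5 l q)
    (fun l hl => by
      rw [(hcol q hqJ hqt hqn l (by omega)).1, h.lin q hqJ, h.lin t htJ])
  obtain ⟨e1, e2, e3, e4⟩ := hker
  exact ⟨hqn, e1, e2, e3, hz, fun l hl => hmax4 l hl hl, e4⟩

/-- Move `x` along the chosen column, scaled to maximum norm `1 / L`, in the direction in which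
`‖x‖` does not decrease. -/
def move : Prog :=
  .seq (.accum 10 (.lit 0) (.lit 0) 11 (.reg 1)
      (.mul (.get 1 (.lit 0) (.reg 11))
        (.div (.get 5 (.reg 11) (.reg 9)) (.get 5 (.reg 8) (.reg 9)))))
    (.seq (.setArr 8 (.lit 0) (.lit 0) (.div (.ofIdx (.lit 1)) (.ofIdx (.reg 3))))
      (.seq (.branch (.rLt (.get 10 (.lit 0) (.lit 0)) (.ofIdx (.lit 0)))
          (.setArr 8 (.lit 0) (.lit 0)
            (.sub (.ofIdx (.lit 0)) (.div (.ofIdx (.lit 1)) (.ofIdx (.reg 3)))))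
          .skip)
        (.forLt 11 (.reg 1)
          (.setArr 1 (.lit 0) (.reg 11) (.add (.get 1 (.lit 0) (.reg 11))
            (.mul (.get 8 (.lit 0) (.lit 0))
              (.div (.get 5 (.reg 11) (.reg 9)) (.get 5 (.reg 8) (.reg 9)))))))))

theorem halts_move {S : ℕ} {s : Memory} (hS : s.idx 1 ≤ S) :
    Halts S move s fun s' => ∀ j < s.idx 1, s'.arr 1 0 j = s.arr 1 0 j +
      (if ∑ l ∈ range (s.idx 1), s.arr 1 0 l *
          (s.arr 5 l (s.idx 9) / s.arr 5 (s.idx 8) (s.idx 9)) < 0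
        then -(1 / (s.idx 3 : ℝ)) else 1 / (s.idx 3 : ℝ)) *
      (s.arr 5 j (s.idx 9) / s.arr 5 (s.idx 8) (s.idx 9)) := by
  set z : ℕ → ℝ := fun l => s.arr 5 l (s.idx 9) / s.arr 5 (s.idx 8) (s.idx 9) with hz
  refine Halts.seq (Halts.accum (fun l => s.arr 1 0 l * z l) rfl rfl rfl hS ?_ fun s₁ hF1 h10 => ?_)
  · intro j _ s₁ hF1 hs1
    simp [RExpr.eval, IExpr.eval, hs1, hF1.arr 1 rfl, hF1.arr 5 rfl, hF1.idx 8 rfl,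
      hF1.idx 9 rfl, hz]
  set u := ∑ l ∈ range (s.idx 1), s.arr 1 0 l * z l with hu
  have hu' : s₁.arr 10 0 0 = u := by
    rw [h10]
    simp [IExpr.eval, hu]
  have b1 : s₁.arr 1 = s.arr 1 := hF1.arr 1 rfl
  have b5 : s₁.arr 5 = s.arr 5 := hF1.arr 5 rfl
  have j1 : s₁.idx 1 = s.idx 1 := hF1.idx 1 rfl
  have j3 : s₁.idx 3 = s.idx 3 := hF1.idx 3 rfl
  have j8 : s₁.idx 8 = s.idx 8 := hF1.idx 8 rfl
  have j9 : s₁.idx 9 = s.idx 9 := hF1.idx 9 rfl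
  set c : ℝ := if u < 0 then -(1 / (s.idx 3 : ℝ)) else 1 / (s.idx 3 : ℝ) with hc
  have hloop : ∀ s₂ : Memory, s₂.arr 1 = s.arr 1 → s₂.arr 5 = s.arr 5 → s₂.idx = s₁.idx →
      s₂.arr 8 0 0 = c → Halts S (.forLt 11 (.reg 1)
          (.setArr 1 (.lit 0) (.reg 11) (.add (.get 1 (.lit 0) (.reg 11))
            (.mul (.get 8 (.lit 0) (.lit 0))
              (.div (.get 5 (.reg 11) (.reg 9)) (.get 5 (.reg 8) (.reg 9))))))) s₂
        fun s' => ∀ j < s.idx 1, s'.arr 1 0 j = s.arr 1 0 j + c * z j := by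
    intro s₂ c1 c5 ci c8
    refine Halts.forLt (fun k s' => (∀ j < k, s'.arr 1 0 j = s.arr 1 0 j + c * z j) ∧
      ∀ j, k ≤ j → s'.arr 1 0 j = s.arr 1 0 j) rfl rfl (by simpa [IExpr.eval, ci, j1] using hS)
      ⟨fun j hj => absurd hj (Nat.not_lt_zero j), fun j _ => by simp [Memory.setIdx, c1]⟩ ?_ ?_
    · rintro k - s' hF hs ⟨hI1, hI2⟩
      have d5 : s'.arr 5 = s.arr 5 := (hF.arr 5 rfl).trans c5
      have d8 : s'.arr 8 = s₂.arr 8 := hF.arr 8 rfl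
      have k8 : s'.idx 8 = s.idx 8 := (hF.idx 8 rfl).trans ((congrFun ci 8).trans j8)
      have k9 : s'.idx 9 = s.idx 9 := (hF.idx 9 rfl).trans ((congrFun ci 9).trans j9)
      refine Halts.setArr ⟨fun j hj => ?_, fun j hj => ?_⟩
      · rcases Nat.lt_succ_iff_lt_or_eq.1 hj with h | rfl
        · simpa [Memory.setIdx, Memory.setArr, IExpr.eval, hs, h.ne] using hI1 j h
        · simp [Memory.setIdx, Memory.setArr, IExpr.eval, RExpr.eval, hs, d5, d8, c8, k8, k9, hz,
            hI2 j le_rfl]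
      · have : j ≠ k := by omega
        simpa [Memory.setIdx, Memory.setArr, IExpr.eval, hs, this] using hI2 j (by omega)
    · rintro s' hF ⟨hI1, -⟩
      simpa only [IExpr.eval, ci, j1] using hI1
  refine Halts.seq (Halts.setArr (Halts.seq (Halts.branch (fun hb => ?_) fun hb => ?_)))
  · have hb : u < 0 := by
      simpa [Test.Holds, RExpr.eval, IExpr.eval, Memory.setArr, hu'] using hb
    refine Halts.setArr (hloop _ ?_ ?_ rfl ?_)
    · funext l j
      simp [Memory.setArr, b1]
    · funext l j
      simp [Memory.setArr, b5]
    · simp [Memory.setArr, RExpr.eval, IExpr.eval, j3, hc, hb]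
  · have hb : ¬ u < 0 := by
      simpa [Test.Holds, RExpr.eval, IExpr.eval, Memory.setArr, hu'] using hb
    refine Halts.skip (hloop _ ?_ ?_ rfl ?_)
    · funext l j
      simp [Memory.setArr, b1]
    · funext l j
      simp [Memory.setArr, b5]
    · simp [Memory.setArr, RExpr.eval, IExpr.eval, j3, hc, hb]

/-- One round of the walk. -/
def round : Prog :=
  .seq markAlive (.branch (.iLt (.lit 2) (.reg 7))
    (.seq rowWeights (.seq initForm (.seq eliminate (.seq direction move)))) .skip)

theorem halts_round {S : ℕ} {s : Memory} (h0 : s.idx 0 ≤ S) (h1 : s.idx 1 + 1 ≤ S)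
    (h2 : s.idx 2 ≤ S) (hsc : 0 ≤ s.arr 2 0 0) :
    Halts S round s fun s' =>
      ((alive (s.idx 1) (s.arr 1 0)).card ≤ 2 → s'.arr 1 = s.arr 1) ∧
      (3 ≤ (alive (s.idx 1) (s.arr 1 0)).card →
        IsGoodStep (s.arr 0) (rowWeight (s.arr 0) (s.idx 1) (s.arr 2 0 0) (s.idx 2) (s.arr 1 0))
          (s.arr 1 0) (s.idx 0) (s.idx 1) (alive (s.idx 1) (s.arr 1 0)) (1 / (s.idx 3 : ℝ))
          fun l => s'.arr 1 0 l - s.arr 1 0 l) := by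
  set N := alive (s.idx 1) (s.arr 1 0) with hN
  refine Halts.seq (Halts.imp (halts_markAlive (by omega)) ?_)
  rintro s₁ hF1 ⟨hfl1, hc1⟩
  have a0 : s₁.arr 0 = s.arr 0 := hF1.arr 0 rfl
  have a1 : s₁.arr 1 = s.arr 1 := hF1.arr 1 rfl
  have a2 : s₁.arr 2 = s.arr 2 := hF1.arr 2 rfl
  have i0 : s₁.idx 0 = s.idx 0 := hF1.idx 0 rfl
  have i1 : s₁.idx 1 = s.idx 1 := hF1.idx 1 rfl
  have i2 : s₁.idx 2 = s.idx 2 := hF1.idx 2 rfl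
  have i3 : s₁.idx 3 = s.idx 3 := hF1.idx 3 rfl
  rw [← hN] at hfl1 hc1
  refine Halts.branch (fun hb => ?_) (fun hb => ?_)
  swap
  · simp only [Test.Holds, IExpr.eval, hc1, not_lt] at hb
    exact Halts.skip ⟨fun _ => a1, fun h => by omega⟩
  have hb : 2 < N.card := by simpa [Test.Holds, IExpr.eval, hc1] using hb
  set w := rowWeight (s.arr 0) (s.idx 1) (s.arr 2 0 0) (s.idx 2) (s.arr 1 0) with hwdef
  have hw : ∀ i < s.idx 0, 0 ≤ w i := fun i _ => by
    rw [hwdef, rowWeight]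
    positivity
  refine Halts.seq (Halts.imp (halts_rowWeights (by omega) (by omega) (by omega)) ?_)
  intro s₂ hF2 h34
  rw [i0, i1, i2, a0, a1, a2, ← hwdef] at h34
  have b0 : s₂.arr 0 = s.arr 0 := (hF2.arr 0 rfl).trans a0
  have b1 : s₂.arr 1 = s.arr 1 := (hF2.arr 1 rfl).trans a1
  have b7 : s₂.arr 7 = s₁.arr 7 := hF2.arr 7 rfl
  have j0 : s₂.idx 0 = s.idx 0 := (hF2.idx 0 rfl).trans i0
  have j1 : s₂.idx 1 = s.idx 1 := (hF2.idx 1 rfl).trans i1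
  have j3 : s₂.idx 3 = s.idx 3 := (hF2.idx 3 rfl).trans i3
  have j7 : s₂.idx 7 = N.card := (hF2.idx 7 rfl).trans hc1
  refine Halts.seq (Halts.imp (halts_initForm (by omega) (by omega)) ?_)
  intro s₃ hF3 h56
  rw [j0, j1, b0, gram_congr (fun i hi => (h34 i hi).2)] at h56
  have c1 : s₃.arr 1 = s.arr 1 := (hF3.arr 1 rfl).trans b1
  have c7 : s₃.arr 7 = s₁.arr 7 := (hF3.arr 7 rfl).trans b7
  have k1 : s₃.idx 1 = s.idx 1 := (hF3.idx 1 rfl).trans j1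
  have k3 : s₃.idx 3 = s.idx 3 := (hF3.idx 3 rfl).trans j3
  have k7 : s₃.idx 7 = N.card := (hF3.idx 7 rfl).trans j7
  have hNlt : ∀ j ∈ N, j < s.idx 1 := fun j hj => (mem_alive.1 hj).1
  have hunit : ∀ (B : ℕ → ℝ) (j : ℕ), j < s.idx 1 →
      ∑ l ∈ range (s.idx 1), B l * s₃.arr 5 l j = B j := by
    intro B j hj
    rw [sum_congr rfl fun l hl => by rw [((h56 j hj).1 l (mem_range.1 hl)).1]]
    simp [hj]
  have hred : Reduced (s.arr 0) w (s.idx 0) (s₃.idx 1)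
      (grad (s.arr 0) w (s.idx 0) (s.idx 1) (s.arr 1 0)) N N (Fin.elim0 : Fin 0 → ℕ) s₃ := by
    rw [k1]
    refine ⟨fun a => a.elim0, Elim.init hNlt fun l hl j hj => ((h56 j hj).1 l hl).1,
      fun j hj => ?_, fun j hj l hl => ?_, fun j hj => ?_⟩
    · rw [c7]
      exact hfl1 j (by omega)
    · rw [((h56 j (hNlt j hj)).1 l hl).2, rowDot, hunit _ j (hNlt j hj)]
    · rw [hunit _ j (hNlt j hj), (h56 j (hNlt j hj)).2, grad]
      exact sum_congr rfl fun i hi => by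
        rw [(h34 i (mem_range.1 hi)).1, (h34 i (mem_range.1 hi)).2]
  refine Halts.seq (Halts.imp (halts_eliminate hw k7 (by omega) hred) ?_)
  rintro s₄ hF4 ⟨J, τ, hred4⟩
  have d1 : s₄.arr 1 = s.arr 1 := (hF4.arr 1 rfl).trans c1
  have l1 : s₄.idx 1 = s.idx 1 := (hF4.idx 1 rfl).trans k1
  have l3 : s₄.idx 3 = s.idx 3 := (hF4.idx 3 rfl).trans k3
  rw [k1, ← l1] at hred4
  refine Halts.seq (Halts.imp (halts_direction hw (by omega) hb hred4) ?_)
  rintro s₅ hF5 ⟨hq, hqq, hsupp, hlin, ht, hmax, μ, hμ, hdet, hquad⟩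
  rw [l1] at hq hsupp hlin ht hmax hquad
  have e1 : s₅.arr 1 = s.arr 1 := (hF5.arr 1 rfl).trans d1
  have m1 : s₅.idx 1 = s.idx 1 := (hF5.idx 1 rfl).trans l1
  have m3 : s₅.idx 3 = s.idx 3 := (hF5.idx 3 rfl).trans l3
  refine Halts.imp (halts_move (by omega)) ?_
  intro s₆ hF6 hmove
  rw [m1, m3, e1] at hmove
  refine ⟨fun h => by omega, fun _ => ?_⟩
  exact isGoodStep_of_direction (y := fun l => s₅.arr 5 l (s₅.idx 9)) (by positivity) hq hqq hsupp
    hlin ht hmax (fun a => hNlt _ (hred4.elim.mem a)) hμ hdet hquad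
    (fun l hl => by rw [hmove l hl]; ring)

end RealRAM

theorem slack_pos {n : ℕ} {x : ℕ → ℝ} (hx : ∀ j < n, |x j| ≤ 1) (h : (alive n x).Nonempty) :
    0 < slack n x := by
  obtain ⟨j, hj⟩ := h
  obtain ⟨hjn, hj⟩ := mem_alive.1 hj
  refine sum_pos' (fun l hl => ?_) ⟨j, mem_range.2 hjn, ?_⟩
  · have : x l ^ 2 ≤ 1 := (sq_le_one_iff_abs_le_one _).2 (hx l (mem_range.1 hl))
    linarith
  · have : 0 < 1 / (n : ℝ) := by
      have : (0 : ℝ) < n := by exact_mod_cast (Nat.zero_le j).trans_lt hjn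
      positivity
    nlinarith

namespace RealRAM

/-! ### The whole program -/

/-- The largest square of an entry of `A`, in array `2`. -/
def findScale : Prog :=
  .forLt 10 (.reg 0) (.forLt 11 (.reg 1)
    (.branch (.rLt (.get 2 (.lit 0) (.lit 0))
        (.mul (.get 0 (.reg 10) (.reg 11)) (.get 0 (.reg 10) (.reg 11))))
      (.setArr 2 (.lit 0) (.lit 0)
        (.mul (.get 0 (.reg 10) (.reg 11)) (.get 0 (.reg 10) (.reg 11))))
      .skip))

theorem halts_findScale {S : ℕ} {s : Memory} (h0 : s.idx 0 ≤ S) (h1 : s.idx 1 ≤ S)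
    (h2 : s.arr 2 0 0 = 0) :
    Halts S findScale s fun s' =>
      (∀ i < s.idx 0, ∀ j < s.idx 1, s.arr 0 i j * s.arr 0 i j ≤ s'.arr 2 0 0) ∧
      (s'.arr 2 0 0 = 0 ∨ ∃ i < s.idx 0, ∃ j < s.idx 1,
        s'.arr 2 0 0 = s.arr 0 i j * s.arr 0 i j) := by
  refine Halts.forLt (fun k s' =>
      (∀ i < k, ∀ j < s.idx 1, s.arr 0 i j * s.arr 0 i j ≤ s'.arr 2 0 0) ∧
      (s'.arr 2 0 0 = 0 ∨ ∃ i < s.idx 0, ∃ j < s.idx 1,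
        s'.arr 2 0 0 = s.arr 0 i j * s.arr 0 i j)) rfl rfl h0
      ⟨fun i hi => absurd hi (Nat.not_lt_zero i), Or.inl h2⟩ ?_ fun s' _ h => h
  rintro k hk s₁ hF1 hs1 ⟨hI1, hI2⟩
  have i1 : s₁.idx 1 = s.idx 1 := hF1.idx 1 rfl
  refine Halts.forLt (fun q s' =>
      (∀ i < k, ∀ j < s.idx 1, s.arr 0 i j * s.arr 0 i j ≤ s'.arr 2 0 0) ∧
      (∀ j < q, s.arr 0 k j * s.arr 0 k j ≤ s'.arr 2 0 0) ∧
      (s'.arr 2 0 0 = 0 ∨ ∃ i < s.idx 0, ∃ j < s.idx 1,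
        s'.arr 2 0 0 = s.arr 0 i j * s.arr 0 i j)) rfl rfl (by simpa [IExpr.eval, i1] using h1)
      ⟨hI1, fun i hi => absurd hi (Nat.not_lt_zero i), hI2⟩ ?_ ?_
  · rintro q hq s₂ hF2 hs2 ⟨hI3, hI4, hI5⟩
    simp only [IExpr.eval, i1] at hq
    have hA : RExpr.eval s₂ (.mul (.get 0 (.reg 10) (.reg 11)) (.get 0 (.reg 10) (.reg 11))) =
        s.arr 0 k q * s.arr 0 k q := by
      have a0 : s₂.arr 0 = s.arr 0 := (hF2.arr 0 rfl).trans (hF1.arr 0 rfl)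
      have i10 : s₂.idx 10 = k := (hF2.idx 10 rfl).trans hs1
      simp [RExpr.eval, IExpr.eval, a0, i10, hs2]
    refine Halts.branch (fun hb => Halts.setArr ?_) (fun hb => Halts.skip ?_)
    · simp only [Test.Holds, hA] at hb
      rw [hA]
      simp only [RExpr.eval, IExpr.eval] at hb
      simp only [Memory.setIdx, Memory.setArr, IExpr.eval, and_self, if_true]
      refine ⟨fun i hi j hj => (hI3 i hi j hj).trans hb.le, fun j hj => ?_,
        Or.inr ⟨k, hk, q, hq, rfl⟩⟩
      rcases Nat.lt_succ_iff_lt_or_eq.1 hj with h | rfl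
      · exact (hI4 j h).trans hb.le
      · exact le_rfl
    · simp only [Test.Holds, hA] at hb
      simp only [RExpr.eval, IExpr.eval, not_lt] at hb
      refine ⟨hI3, fun j hj => ?_, hI5⟩
      rcases Nat.lt_succ_iff_lt_or_eq.1 hj with h | rfl
      · exact hI4 j h
      · exact hb
  · rintro s₂ hF2 ⟨hI3, hI4, hI5⟩
    simp only [IExpr.eval, i1] at hI4
    refine ⟨fun i hi => ?_, hI5⟩
    rcases Nat.lt_succ_iff_lt_or_eq.1 hi with h | rfl
    · exact hI3 i h
    · exact hI4

/-- The least `p` with `m ≤ 2 ^ p`, in register `2`. -/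
def findLog : Prog :=
  .seq (.setIdx 13 (.lit 1)) (.seq (.setIdx 2 (.lit 0))
    (.forLt 10 (.reg 0) (.branch (.iLt (.reg 13) (.reg 0))
      (.seq (.setIdx 13 (.add (.reg 13) (.reg 13))) (.setIdx 2 (.add (.reg 2) (.lit 1))))
      .skip)))

theorem halts_findLog {S : ℕ} {s : Memory} (h0 : s.idx 0 ≤ S) :
    Halts S findLog s fun s' => s.idx 0 ≤ 2 ^ s'.idx 2 ∧
      (s'.idx 2 = 0 ∨ 2 ^ (s'.idx 2 - 1) < s.idx 0) := by
  refine Halts.seq (Halts.setIdx (Halts.seq (Halts.setIdx ?_)))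
  refine Halts.forLt (fun k s' => s'.idx 13 = 2 ^ s'.idx 2 ∧
    (s.idx 0 ≤ 2 ^ s'.idx 2 ∨ k < 2 ^ s'.idx 2) ∧
    (s'.idx 2 = 0 ∨ 2 ^ (s'.idx 2 - 1) < s.idx 0)) rfl rfl
    (by simpa [IExpr.eval, Memory.setIdx] using h0) ?_ ?_ ?_
  · simp [Memory.setIdx, IExpr.eval]
  · rintro k - s' hF hs ⟨h13, hI1, hI2⟩
    have i0 : s'.idx 0 = s.idx 0 := hF.idx 0 rfl
    refine Halts.branch (fun hb => Halts.seq (Halts.setIdx (Halts.setIdx ?_)))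
      (fun hb => Halts.skip ?_)
    · simp only [Test.Holds, IExpr.eval, h13, i0] at hb
      simp only [Memory.setIdx, IExpr.eval, h13]
      refine ⟨?_, Or.inr ?_, Or.inr ?_⟩
      · simp [pow_succ, mul_two]
      · have := hI1.resolve_left (by omega)
        simp only [Nat.reduceEqDiff, if_false, if_true, pow_succ]
        omega
      · simpa using hb
    · simp only [Test.Holds, IExpr.eval, h13, i0, not_lt] at hb
      exact ⟨by simpa [Memory.setIdx] using h13, Or.inl (by simpa [Memory.setIdx] using hb),
        by simpa [Memory.setIdx] using hI2⟩
  · rintro s' hF ⟨-, hI1, hI2⟩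
    simp only [IExpr.eval, Memory.setIdx] at hI1
    exact ⟨hI1.elim id fun h => (by simpa using h.le), hI2⟩

/-- Register `z` becomes the product of `e` and `f`. -/
def mulIdx (z : ℕ) (e : IExpr) (x : ℕ) (f : IExpr) : Prog :=
  .seq (.setIdx z (.lit 0)) (.forLt x f (.setIdx z (.add (.reg z) e)))

theorem halts_mulIdx {S : ℕ} {s : Memory} {z x : ℕ} {e f : IExpr} (hx : (x == z) = false)
    (he : e.readsFrom (mulIdx z e x f) = false) (hf : f.readsFrom (mulIdx z e x f) = false)
    (hf' : f.readsFrom (.forLt x f (.setIdx z (.add (.reg z) e))) = false)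
    (hS : f.eval s ≤ S) :
    Halts S (mulIdx z e x f) s fun s' => s'.idx z = f.eval s * e.eval s := by
  refine Halts.seq (Halts.setIdx ?_)
  have hF0 : Frame (mulIdx z e x f) s (s.setIdx z 0) :=
    (Frame.refl _ _).setIdx (by simp [mulIdx, Prog.writesIdx])
  have ef : f.eval (s.setIdx z 0) = f.eval s := hF0.eval_eq hf
  have hxz : z ≠ x := fun h => by simp [h] at hx
  simp only [IExpr.eval]
  refine Halts.forLt (fun k s' => s'.idx z = k * e.eval s) hx hf' (by rwa [ef]) ?_ ?_ ?_
  · simp [Memory.setIdx, hxz]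
  · intro k _ s' hF _ hI
    have ee : e.eval s' = e.eval s := (hF0.trans (hF.mono
      (by simp +contextual [mulIdx, Prog.forLt, Prog.writesArr])
      (by simp +contextual [mulIdx, Prog.forLt, Prog.writesIdx]))).eval_eq he
    refine Halts.setIdx ?_
    simp [Memory.setIdx, IExpr.eval, hxz, hI, ee, Nat.add_mul]
  · intro s' _ hI
    rwa [ef] at hI

/-- `L = 4 m n` in register `3`, and the number of rounds, `n L²`, in register `5`. -/
def findLengths : Prog :=
  .seq (mulIdx 3 (.add (.add (.reg 1) (.reg 1)) (.add (.reg 1) (.reg 1))) 10 (.reg 0))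
    (.seq (mulIdx 4 (.reg 3) 10 (.reg 3)) (mulIdx 5 (.reg 1) 10 (.reg 4)))

theorem halts_findLengths {S m n : ℕ} {s : Memory} (hm : s.idx 0 = m) (hn : s.idx 1 = n)
    (h1 : m ≤ S) (h2 : m * (4 * n) ≤ S) (h3 : (m * (4 * n)) ^ 2 ≤ S) :
    Halts S findLengths s fun s' =>
      s'.idx 3 = m * (4 * n) ∧ s'.idx 5 = (m * (4 * n)) ^ 2 * n := by
  refine Halts.seq (Halts.imp (halts_mulIdx rfl rfl rfl rfl (by simpa [IExpr.eval, hm])) ?_)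
  intro s₁ hF1 e3
  have e3 : s₁.idx 3 = m * (4 * n) := by
    rw [e3]
    simp only [IExpr.eval, hm, hn]
    ring
  have i1 : s₁.idx 1 = n := (hF1.idx 1 rfl).trans hn
  refine Halts.seq (Halts.imp (halts_mulIdx rfl rfl rfl rfl (by simpa [IExpr.eval, e3])) ?_)
  intro s₂ hF2 e4
  have j1 : s₂.idx 1 = n := (hF2.idx 1 rfl).trans i1
  have j3 : s₂.idx 3 = m * (4 * n) := (hF2.idx 3 rfl).trans e3
  have e4 : s₂.idx 4 = (m * (4 * n)) ^ 2 := by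
    rw [e4]
    simp only [IExpr.eval, e3]
    ring
  refine Halts.imp (halts_mulIdx rfl rfl rfl rfl (by simpa [IExpr.eval, e4])) ?_
  intro s₃ hF3 e5
  refine ⟨(hF3.idx 3 rfl).trans j3, ?_⟩
  rw [e5]
  simp only [IExpr.eval, e4, j1]

/-- All rounds of the walk. -/
def walk : Prog := .forLt 6 (.reg 5) round

theorem halts_walk {S m n p : ℕ} {A : ℕ → ℕ → ℝ} {sc lam : ℝ} {s : Memory} (hm1 : 1 ≤ m)
    (hn1 : 1 ≤ n) (hp : 1 ≤ p) (hpm : p ≤ m)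
    (i0 : s.idx 0 = m) (i1 : s.idx 1 = n) (i2 : s.idx 2 = p) (i3 : s.idx 3 = m * (4 * n))
    (i5 : s.idx 5 = (m * (4 * n)) ^ 2 * n) (a0 : s.arr 0 = A) (a1 : s.arr 1 0 = 0)
    (a2 : s.arr 2 0 0 = sc) (hmS : m ≤ S) (hnS : n + 1 ≤ S) (hTS : (m * (4 * n)) ^ 2 * n ≤ S)
    (hsc : 0 ≤ sc) (hA : ∀ i < m, ∀ j < n, A i j * A i j ≤ sc) (hlam : 0 ≤ lam)
    (hdet : ∀ (k : ℕ) (τ : Fin k → ℕ), (∀ a, τ a < n) → ∀ f : Fin k → Fin m,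
      |(Matrix.of fun a b => A (f a) (τ b)).det| ≤ lam ^ k) :
    Halts S walk s fun s' => 0 < sc → (∀ j < n, |s'.arr 1 0 j| ≤ 1) ∧
      (alive n (s'.arr 1 0)).card ≤ 2 ∧
      potential A m n sc p (s'.arr 1 0) ≤ m * levelBound n sc p lam (s'.arr 1 0) ^ p := by
  have hLpos : (0 : ℝ) < ((m * (4 * n) : ℕ) : ℝ) := by
    exact_mod_cast Nat.mul_pos hm1 (by omega)
  have hm' : (1 : ℝ) ≤ m := by exact_mod_cast hm1
  have hn' : (1 : ℝ) ≤ n := by exact_mod_cast hn1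
  have hpm' : (p : ℝ) ≤ m := by exact_mod_cast hpm
  set L : ℝ := ((m * (4 * n) : ℕ) : ℝ) with hL
  have hL' : L = m * (4 * n) := by rw [hL]; push_cast; ring
  refine Halts.forLt (fun k s' => 0 < sc → (∀ j < n, |s'.arr 1 0 j| ≤ 1) ∧
      potential A m n sc p (s'.arr 1 0) ≤ m * levelBound n sc p lam (s'.arr 1 0) ^ p ∧
      ((alive n (s'.arr 1 0)).card ≤ 2 ∨ slack n (s'.arr 1 0) ≤ n - k * (1 / L) ^ 2))
      rfl rfl (by simpa [IExpr.eval, i5] using hTS) ?_ ?_ ?_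
  · intro _
    have hslack : slack n 0 = n := by simp [slack]
    simp only [Memory.setIdx, a1]
    refine ⟨fun j _ => by simp, ?_, Or.inr ?_⟩
    · rw [levelBound, hslack]
      simp [potential, rowDot]
    · rw [hslack]
      simp
  · intro k hk s' hF hs hI
    have a0' : s'.arr 0 = A := (hF.arr 0 rfl).trans a0
    have a2' : s'.arr 2 0 0 = sc := (congrFun (congrFun (hF.arr 2 rfl) 0) 0).trans a2
    have j0 : s'.idx 0 = m := (hF.idx 0 rfl).trans i0
    have j1 : s'.idx 1 = n := (hF.idx 1 rfl).trans i1
    have j2 : s'.idx 2 = p := (hF.idx 2 rfl).trans i2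
    have j3 : s'.idx 3 = m * (4 * n) := (hF.idx 3 rfl).trans i3
    refine Halts.imp (halts_round (by omega) (by omega) (by omega) (by rwa [a2'])) ?_
    rintro s'' hF' ⟨hidle, hgo⟩ hsc0
    rw [j1] at hidle
    rw [j0, j1, j2, j3, a0', a2', ← hL] at hgo
    obtain ⟨hx, hpot, hprog⟩ := hI hsc0
    simp only [Memory.setIdx]
    rcases Nat.lt_or_ge 2 (alive n (s'.arr 1 0)).card with h | h
    · have hgood := hgo h
      have hstep := hgood.progress h hp hsc0 ?_ ?_ ?_ hlam hdet hx hpot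
      · simp only [add_sub_cancel] at hstep
        refine ⟨hstep.1, hstep.2.2, Or.inr ?_⟩
        have h1 := hprog.resolve_left (by omega)
        have h2 := hstep.2.1
        push_cast
        change slack n (s''.arr 1 0) ≤ _ at h2
        linarith
      · intro i hi j hj
        refine Real.abs_le_sqrt ?_
        rw [sq]
        exact hA i hi j hj
      · rw [mul_one_div, div_le_one hLpos, hL']
        nlinarith
      · rw [mul_one_div, div_le_one hLpos, hL']
        nlinarith
    · rw [hidle h]
      exact ⟨hx, hpot, Or.inl h⟩
  · intro s' hF hI hsc0
    obtain ⟨hx, hpot, hprog⟩ := hI hsc0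
    refine ⟨hx, ?_, hpot⟩
    by_contra hcard
    have h1 := hprog.resolve_left hcard
    have h2 := slack_pos hx (card_pos.1 (by omega))
    have h3 : ((IExpr.eval s (.reg 5) : ℕ) : ℝ) * (1 / L) ^ 2 = n := by
      simp only [IExpr.eval, i5]
      rw [Nat.cast_mul, Nat.cast_pow, ← hL]
      field_simp
    rw [h3] at h1
    linarith

/-- Replace every coordinate of `x` by its sign. -/
def roundSigns : Prog :=
  .forLt 11 (.reg 1) (.branch (.rLt (.get 1 (.lit 0) (.reg 11)) (.ofIdx (.lit 0)))
    (.setArr 1 (.lit 0) (.reg 11) (.sub (.ofIdx (.lit 0)) (.ofIdx (.lit 1))))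
    (.setArr 1 (.lit 0) (.reg 11) (.ofIdx (.lit 1))))

theorem halts_roundSigns {S : ℕ} {s : Memory} (h1 : s.idx 1 ≤ S) :
    Halts S roundSigns s fun s' => ∀ j < s.idx 1,
      s'.arr 1 0 j = if s.arr 1 0 j < 0 then -1 else 1 := by
  refine Halts.forLt (fun k s' => (∀ j < k, s'.arr 1 0 j = if s.arr 1 0 j < 0 then -1 else 1) ∧
    ∀ j, k ≤ j → s'.arr 1 0 j = s.arr 1 0 j) rfl rfl h1
    ⟨fun j hj => absurd hj (Nat.not_lt_zero j), fun j _ => rfl⟩ ?_ fun s' _ h => h.1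
  rintro k - s' hF hs ⟨hI1, hI2⟩
  have hrest : ∀ v : ℝ, v = (if s.arr 1 0 k < 0 then -1 else 1) →
      (∀ j < k + 1, ((s'.setArr 1 0 k v).setIdx 11 (k + 1)).arr 1 0 j =
        if s.arr 1 0 j < 0 then -1 else 1) ∧
      ∀ j, k + 1 ≤ j → ((s'.setArr 1 0 k v).setIdx 11 (k + 1)).arr 1 0 j = s.arr 1 0 j := by
    intro v hv
    refine ⟨fun j hj => ?_, fun j hj => ?_⟩
    · rcases Nat.lt_succ_iff_lt_or_eq.1 hj with h | rfl
      · simpa [Memory.setIdx, Memory.setArr, h.ne] using hI1 j h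
      · simp [Memory.setIdx, Memory.setArr, hv]
    · have : j ≠ k := by omega
      simpa [Memory.setIdx, Memory.setArr, this] using hI2 j (by omega)
  refine Halts.branch (fun hb => Halts.setArr ?_) (fun hb => Halts.setArr ?_)
  · have hb : s.arr 1 0 k < 0 := by
      simpa [Test.Holds, RExpr.eval, IExpr.eval, hs, hI2 k le_rfl] using hb
    simp only [IExpr.eval, hs]
    exact hrest _ (by simp [RExpr.eval, IExpr.eval, hb])
  · have hb : ¬ s.arr 1 0 k < 0 := by
      simpa [Test.Holds, RExpr.eval, IExpr.eval, hs, hI2 k le_rfl] using hb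
    simp only [IExpr.eval, hs]
    exact hrest _ (by simp [RExpr.eval, IExpr.eval, hb])

/-- The coloring program.  It does nothing if `m < 2` or `n < 2`. -/
def colorProg : Prog :=
  .branch (.conj (.iLt (.lit 1) (.reg 0)) (.iLt (.lit 1) (.reg 1)))
    (.seq findScale (.seq findLog (.seq findLengths (.seq walk roundSigns))))
    .skip

end RealRAM

/-- The final computation with constants. -/
theorem abs_le_of_level {m n p : ℕ} {lam b r : ℝ} (hm : 2 ≤ m) (hn : 2 ≤ n) (hp : 1 ≤ p)
    (hpm : 2 ^ (p - 1) < m) (hlam : 0 ≤ lam)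
    (hb : b ^ 2 ≤ 2 * (lam ^ 2 + 500 * p * lam ^ 2 * Real.log (1 + n)))
    (hr : |r| ≤ |b| + 3 * lam) :
    |r| ≤ 100 * √(Real.log m * Real.log n) * lam := by
  have hl2 := Real.log_two_gt_d9
  have hm' : (2 : ℝ) ≤ m := by exact_mod_cast hm
  have hn' : (2 : ℝ) ≤ n := by exact_mod_cast hn
  have hlm : Real.log 2 ≤ Real.log m := Real.log_le_log (by norm_num) hm'
  have hln : Real.log 2 ≤ Real.log n := Real.log_le_log (by norm_num) hn'
  have hp3 : (p : ℝ) ≤ 3 * Real.log m := by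
    have h1 : ((p - 1 : ℕ) : ℝ) * Real.log 2 ≤ Real.log m := by
      rw [← Real.log_pow]
      exact Real.log_le_log (by positivity) (by exact_mod_cast hpm.le)
    rw [Nat.cast_sub hp, Nat.cast_one] at h1
    nlinarith
  have hn2 : Real.log (1 + n) ≤ 2 * Real.log n := by
    rw [← Nat.cast_two, ← Real.log_pow]
    exact Real.log_le_log (by positivity) (by nlinarith)
  set X := Real.log m * Real.log n with hX
  have hX1 : 0.48 ≤ X := by nlinarith
  have hX2 : √X ^ 2 = X := Real.sq_sqrt (by linarith)
  have hX3 : 0.69 ≤ √X := Real.le_sqrt_of_sq_le (by norm_num; linarith)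
  have hpl : p * Real.log (1 + n) ≤ 6 * X := by
    calc p * Real.log (1 + n) ≤ (3 * Real.log m) * (2 * Real.log n) :=
          mul_le_mul hp3 hn2 (Real.log_nonneg (by linarith)) (by linarith)
      _ = 6 * X := by rw [hX]; ring
  have hb' : |b| ≤ 80 * √X * lam := by
    refine abs_le_of_sq_le_sq ?_ (by positivity)
    calc b ^ 2 ≤ 2 * (lam ^ 2 + 500 * p * lam ^ 2 * Real.log (1 + n)) := hb
      _ = lam ^ 2 * (2 + 1000 * (p * Real.log (1 + n))) := by ring
      _ ≤ lam ^ 2 * (6400 * X) := by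
        gcongr
        linarith
      _ = (80 * √X * lam) ^ 2 := by
        rw [mul_pow, mul_pow, hX2]
        ring
  nlinarith [mul_le_mul_of_nonneg_right hX3 hlam]

namespace RealRAM

theorem halts_colorProg {S m n : ℕ} {A : ℕ → ℕ → ℝ} {lam : ℝ} {s : Memory}
    (i0 : s.idx 0 = m) (i1 : s.idx 1 = n) (a0 : s.arr 0 = A) (a1 : s.arr 1 0 = 0)
    (a2 : s.arr 2 0 0 = 0) (hS : (m * (4 * n)) ^ 2 * n + m + n + 1 ≤ S) (hlam : 0 ≤ lam)
    (hdet : ∀ (k : ℕ) (τ : Fin k → ℕ), (∀ a, τ a < n) → ∀ f : Fin k → Fin m,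
      |(Matrix.of fun a b => A (f a) (τ b)).det| ≤ lam ^ k) :
    Halts S colorProg s fun s' => 2 ≤ m → 2 ≤ n →
      (∀ j < n, s'.arr 1 0 j = 1 ∨ s'.arr 1 0 j = -1) ∧
      ∀ i < m, |rowDot A n (s'.arr 1 0) i| ≤ 100 * √(Real.log m * Real.log n) * lam := by
  refine Halts.branch (fun hb => ?_) (fun hb => Halts.skip fun hm hn => ?_)
  swap
  · exact absurd (by simp only [Test.Holds, IExpr.eval, i0, i1]; omega) hb
  have hb : 1 < m ∧ 1 < n := by simpa [Test.Holds, IExpr.eval, i0, i1] using hb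
  obtain ⟨hm, hn⟩ := hb
  have hent : ∀ i < m, ∀ j < n, |A i j| ≤ lam := by
    intro i hi j hj
    simpa using hdet 1 (fun _ => j) (fun _ => hj) fun _ => ⟨i, hi⟩
  refine Halts.seq (Halts.imp (halts_findScale (by omega) (by omega) a2) ?_)
  rintro s₁ hF1 ⟨hsc1, hsc2⟩
  rw [i0, i1, a0] at hsc1 hsc2
  obtain ⟨sc, hsc⟩ : ∃ sc, s₁.arr 2 0 0 = sc := ⟨_, rfl⟩
  rw [hsc] at hsc1 hsc2
  have hsc0 : 0 ≤ sc := (mul_self_nonneg _).trans (hsc1 0 (by omega) 0 (by omega))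
  have hsclam : sc ≤ lam ^ 2 := by
    rcases hsc2 with h | ⟨i, hi, j, hj, h⟩
    · rw [h]
      positivity
    · rw [h, ← sq, ← sq_abs]
      exact pow_le_pow_left₀ (abs_nonneg _) (hent i hi j hj) 2
  have j0 : s₁.idx 0 = m := (hF1.idx 0 rfl).trans i0
  have j1 : s₁.idx 1 = n := (hF1.idx 1 rfl).trans i1
  refine Halts.seq (Halts.imp (halts_findLog (by omega)) ?_)
  rintro s₂ hF2 ⟨hp1, hp2⟩
  rw [j0] at hp1 hp2
  obtain ⟨p, hp⟩ : ∃ p, s₂.idx 2 = p := ⟨_, rfl⟩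
  rw [hp] at hp1 hp2
  have hp0 : 1 ≤ p := by
    rcases Nat.eq_zero_or_pos p with rfl | h
    · simp at hp1
      omega
    · exact h
  have hp2 : 2 ^ (p - 1) < m := hp2.resolve_left (by omega)
  have hpm : p ≤ m := by
    have := Nat.lt_two_pow_self (n := p - 1)
    omega
  have k0 : s₂.idx 0 = m := (hF2.idx 0 rfl).trans j0
  have k1 : s₂.idx 1 = n := (hF2.idx 1 rfl).trans j1
  have hL1 : 1 ≤ m * (4 * n) := Nat.mul_pos (by omega) (by omega)
  have hL2 : m * (4 * n) ≤ (m * (4 * n)) ^ 2 := Nat.le_self_pow two_ne_zero _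
  have hL3 : (m * (4 * n)) ^ 2 ≤ (m * (4 * n)) ^ 2 * n := Nat.le_mul_of_pos_right _ (by omega)
  refine Halts.seq (Halts.imp (halts_findLengths k0 k1 (by omega) (by omega) (by omega)) ?_)
  rintro s₃ hF3 ⟨h3, h5⟩
  refine Halts.seq (Halts.imp (halts_walk (S := S) (m := m) (n := n) (p := p) (A := A) (sc := sc)
    (lam := lam) (by omega) (by omega) hp0 hpm ((hF3.idx 0 rfl).trans k0)
    ((hF3.idx 1 rfl).trans k1) ((hF3.idx 2 rfl).trans hp) h3 h5 ?_ ?_ ?_ (by omega) (by omega)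
    (by omega) hsc0 hsc1 hlam hdet) ?_)
  · rw [hF3.arr 0 rfl, hF2.arr 0 rfl, hF1.arr 0 rfl, a0]
  · rw [hF3.arr 1 rfl, hF2.arr 1 rfl, hF1.arr 1 rfl, a1]
  · rw [hF3.arr 2 rfl, hF2.arr 2 rfl, hsc]
  intro s₄ hF4 hwalk
  have l1 : s₄.idx 1 = n := ((hF4.idx 1 rfl).trans (hF3.idx 1 rfl)).trans k1
  refine Halts.imp (halts_roundSigns (by omega)) ?_
  intro s₅ _ hsign _ _
  rw [l1] at hsign
  refine ⟨fun j hj => ?_, fun i hi => ?_⟩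
  · rw [hsign j hj]
    split_ifs <;> simp
  rcases hsc0.eq_or_lt with h0 | hpos
  · -- If the scale is zero, then so is the matrix.
    have hz : rowDot A n (s₅.arr 1 0) i = 0 := by
      refine sum_eq_zero fun l hl => ?_
      have h1 := hsc1 i hi l (mem_range.1 hl)
      rw [← h0] at h1
      have h2 : A i l = 0 := by nlinarith [mul_self_nonneg (A i l)]
      rw [h2, zero_mul]
    rw [hz, abs_zero]
    positivity
  · obtain ⟨hx, hcard, hpot⟩ := hwalk hpos
    have hq : levelBound n sc p lam (s₄.arr 1 0) ≤
        lam ^ 2 + 500 * p * lam ^ 2 * Real.log (1 + n) := by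
      have h1 := Real.log_nonneg (x := 1 + slack n (s₄.arr 1 0))
        (by linarith [slack_nonneg hx])
      have h2 : 500 * p * lam ^ 2 *
          (Real.log (1 + n) - Real.log (1 + slack n (s₄.arr 1 0))) ≤
          500 * p * lam ^ 2 * Real.log (1 + n) := by
        gcongr
        linarith
      rw [levelBound]
      linarith
    have hlevel := rowDot_sq_le_of_potential_le hp0 hpos
      (hpos.le.trans (le_levelBound (s := sc) (p := p) (lam := lam) hx)) hp1 hpot hi
    exact abs_le_of_level hm hn hp0 hp2 hlam (by linarith)
      (abs_rowDot_sign_le (by omega) hx hcard (hent i hi) hlam hsign)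

end RealRAM

/-! ### The theorem -/

namespace RealRAM

/-- The minors of `A`, read from the array that holds `A`. -/
theorem abs_det_start_le {m n k : ℕ} (p : Prog) (A : Matrix (Fin m) (Fin n) ℝ) {τ : Fin k → ℕ}
    (hτ : ∀ a, τ a < n) (f : Fin k → Fin m) :
    |(Matrix.of fun a b => (start p A).2.arr 0 (f a) (τ b)).det| ≤ detLB A ^ k := by
  have e : (Matrix.of fun a b => (start p A).2.arr 0 (f a) (τ b)) =
      A.submatrix f fun b => ⟨τ b, hτ b⟩ := by
    ext a b
    simp [start, hτ b]
  rw [e]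
  exact abs_det_submatrix_le_detLB_pow A f _

theorem mulVec_eq_rowDot {m n : ℕ} (p : Prog) (A : Matrix (Fin m) (Fin n) ℝ) (x : ℕ → ℝ)
    (i : Fin m) :
    (A *ᵥ fun j => x j) i = rowDot ((start p A).2.arr 0) n x i := by
  rw [rowDot, Finset.sum_range, Matrix.mulVec, dotProduct]
  exact sum_congr rfl fun j _ => by simp [start]

theorem exists_exec_colorProg : ∃ D : ℕ, ∀ (m n : ℕ) (A : Matrix (Fin m) (Fin n) ℝ),
    ∃ t s', Exec colorProg (start colorProg A).2 t s' ∧ t ≤ D * (m + n + 1) ^ D ∧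
      (2 ≤ m → 2 ≤ n → IsColoring (fun j : Fin n => s'.arr 1 0 j) ∧
        ‖A *ᵥ fun j : Fin n => s'.arr 1 0 j‖ ≤
          100 * √(Real.log m * Real.log n) * detLB A) := by
  obtain ⟨K, hK⟩ := colorProg.cost_le
  refine ⟨K * 18 ^ K + 5 * K, fun m n A => ?_⟩
  have hS : (m * (4 * n)) ^ 2 * n + m + n + 1 + 1 ≤ 18 * (m + n + 1) ^ 5 := by
    have h1 : (m * (4 * n)) ^ 2 * n ≤ 16 * (m + n + 1) ^ 5 := by
      calc (m * (4 * n)) ^ 2 * n = 16 * (m ^ 2 * n ^ 3) := by ring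
        _ ≤ 16 * ((m + n + 1) ^ 2 * (m + n + 1) ^ 3) := by gcongr <;> omega
        _ = _ := by ring
    have h2 : m + n + 1 ≤ (m + n + 1) ^ 5 := Nat.le_self_pow (by norm_num) _
    omega
  obtain ⟨t, s', hexec, ht, hpost⟩ := halts_colorProg
    (S := (m * (4 * n)) ^ 2 * n + m + n + 1) (s := (start colorProg A).2) (m := m) (n := n)
    (A := (start colorProg A).2.arr 0) (lam := detLB A) rfl rfl rfl
    (by funext j; simp [start]) (by simp [start]) le_rfl (detLB_nonneg A)
    fun k τ hτ f => abs_det_start_le colorProg A hτ f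
  refine ⟨t, s', hexec, ?_, fun hm hn => ?_⟩
  · calc t ≤ K * ((m * (4 * n)) ^ 2 * n + m + n + 1 + 1) ^ K := ht.trans (hK _)
      _ ≤ K * (18 * (m + n + 1) ^ 5) ^ K := by gcongr
      _ = K * 18 ^ K * (m + n + 1) ^ (5 * K) := by rw [mul_pow, ← pow_mul]; ring
      _ ≤ (K * 18 ^ K + 5 * K) * (m + n + 1) ^ (K * 18 ^ K + 5 * K) := by
        gcongr <;> omega
  · obtain ⟨h1, h2⟩ := hpost hm hn
    refine ⟨fun j => h1 j j.2, (pi_norm_le_iff_of_nonneg ?_).2 fun i => ?_⟩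
    · have := detLB_nonneg A
      positivity
    · rw [mulVec_eq_rowDot colorProg, Real.norm_eq_abs]
      exact h2 i i.2

end RealRAM

/-- There is an absolute constant `C` such that, for every prescribed exponent `d`, one randomized
program halts on all inputs after polynomially many steps, always outputs a coloring when
`m, n ≥ 2`, and its coloring `x` satisfies
`‖A x‖_∞ ≤ C √(log m · log n) · detLB A` with probability at least `1 - (m + n)^(-d)`.
The norm on `Fin m → ℝ` is the maximum norm. -/
theorem theorem1 :
    ∃ C : ℝ, 0 < C ∧ ∀ d : ℕ, ∃ (p : RealRAM.Prog) (D : ℕ),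
      RealRAM.HaltsWithin p (fun m n => D * (m + n + 1) ^ D) ∧
      ∀ m n : ℕ, 2 ≤ m → 2 ≤ n → ∀ A : Matrix (Fin m) (Fin n) ℝ,
        (∀ x ∈ (RealRAM.outputDist p (D * (m + n + 1) ^ D) A).support, IsColoring x) ∧
        ENNReal.ofReal (1 - 1 / ((m : ℝ) + (n : ℝ)) ^ d) ≤
          (RealRAM.outputDist p (D * (m + n + 1) ^ D) A).toOuterMeasure
            {x | IsColoring x ∧
              ‖A *ᵥ x‖ ≤ C * Real.sqrt (Real.log m * Real.log n) * detLB A} := by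
  obtain ⟨D, hD⟩ := RealRAM.exists_exec_colorProg
  refine ⟨100, by norm_num, fun d => ⟨RealRAM.colorProg, D, fun m n A c hc => ?_,
    fun m n hm hn A => ?_⟩⟩
  · obtain ⟨t, s', hexec, ht, -⟩ := hD m n A
    have hrun : RealRAM.run (D * (m + n + 1) ^ D) (RealRAM.start RealRAM.colorProg A) =
        PMF.pure ([], s') := hexec.run_eq ht
    rw [hrun, PMF.support_pure] at hc
    rw [Set.mem_singleton_iff.1 hc]
  · obtain ⟨t, s', hexec, ht, hpost⟩ := hD m n A
    obtain ⟨hcol, hnorm⟩ := hpost hm hn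
    have hrun : RealRAM.run (D * (m + n + 1) ^ D) (RealRAM.start RealRAM.colorProg A) =
        PMF.pure ([], s') := hexec.run_eq ht
    -- No coin is tossed, so the output distribution is concentrated at one coloring.
    have hout : RealRAM.outputDist RealRAM.colorProg (D * (m + n + 1) ^ D) A =
        PMF.pure fun j : Fin n => s'.arr 1 0 j := by
      rw [RealRAM.outputDist, hrun, PMF.pure_map]
      rfl
    rw [hout]
    refine ⟨fun x hx => ?_, ?_⟩
    · rw [PMF.support_pure, Set.mem_singleton_iff] at hx
      rwa [hx]
    · rw [PMF.toOuterMeasure_pure_apply, if_pos ⟨hcol, hnorm⟩, ENNReal.ofReal_le_one]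
      have : 0 ≤ 1 / ((m : ℝ) + (n : ℝ)) ^ d := by positivity
      linarith
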